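/- Let $n,m\ge 1$ be integers, $T>0$, $x^0\in\mathbb{R}^n$, let $U\subset\mathbb{R}^m$ be a nonempty convex set, and let $f:\mathbb{R}^n\times\mathbb{R}^m\times[0,T]\to\mathbb{R}^n$ be continuous and of class $C^1$ with respect to its first two variables (that is, $\nabla_x f$ and $\nabla_u f$ exist and are continuous on $\mathbb{R}^n\times\mathbb{R}^m\times[0,T]$). A control $u\in L^\infty([0,T],\mathbb{R}^m)$ is admissible if there is an absolutely continuous $x_u:[0,T]\to\mathbb{R}^n$ (necessarily unique) with $x_u(0)=x^0$ and $\dot x_u(t)=f(x_u(t),u(t),t)$ for a.e. $t\in[0,T]$. Let $\mathcal{U}\subset L^\infty([0,T],\mathbb{R}^m)$ be the set of admissible controls, let $E:\mathcal{U}\to\mathbb{R}^n$, $E(u)=x_u(T)$, and let $L^\infty([0,T],U)$ be the set of $v\in L^\infty([0,T],\mathbb{R}^m)$ with $v(t)\in U$ for a.e. $t$. Let $u\in\mathcal{U}\cap L^\infty([0,T],U)$. Then $\mathcal{U}$ is a neighbourhood of $u$ in $L^\infty([0,T],\mathbb{R}^m)$, $E$ is Fréchet differentiable at $u$, and the following two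 statements are equivalent. (a) $u$ is weakly $U$-singular, i.e. the image under $DE(u)$ of the tangent cone $\mathbb{R}_+(L^\infty([0,T],U)-u)=\{\alpha(v-u) : \alpha\ge 0,\ v\in L^\infty([0,T],U)\}$ is not the whole of $\mathbb{R}^n$. (b) The pair $(x_u,u)$ admits a nontrivial weak $U$-extremal lift, i.e. there is an absolutely continuous $p:[0,T]\to\mathbb{R}^n$, not identically zero, such that, with $H(x,u,p,t)=\langle p,f(x,u,t)\rangle$, for a.e. $t\in[0,T]$, $$\dot p(t)=-\nabla_x H(x_u(t),u(t),p(t),t)\quad\text{and}\quad \nabla_u H(x_u(t),u(t),p(t),t)\in\mathcal{N}_U[u(t)],$$ where $\mathcal{N}_U[a]=\{\vartheta\in\mathbb{R}^m : \langle\vartheta,\omega-a\rangle\le 0 \text{ for all } \omega\in U\}$. -/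

import Mathlib

open MeasureTheory Set Topology

namespace ControlSystem

/-- `L^∞([0,T], ℝ^m)`, the normed space of controls (classes modulo a.e. equality). -/
abbrev Control (m : ℕ) (T : ℝ) : Type :=
  Lp (EuclideanSpace ℝ (Fin m)) ⊤ (volume.restrict (Icc (0 : ℝ) T))

variable {n m : ℕ}

/-- Regularity of the dynamics: `f` is continuous on `ℝ^n × ℝ^m × [0,T]` and of class `C^1` with
respect to its first two variables, i.e. differentiable in `(x, u)` with a differential that is
continuous on `ℝ^n × ℝ^m × [0,T]`. -/
structure IsC1Dynamics
    (f : EuclideanSpace ℝ (Fin n) → EuclideanSpace ℝ (Fin m) → ℝ → EuclideanSpace ℝ (Fin n))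
    (T : ℝ) : Prop where
  continuousOn : ContinuousOn
    (fun q : (EuclideanSpace ℝ (Fin n) × EuclideanSpace ℝ (Fin m)) × ℝ => f q.1.1 q.1.2 q.2)
    (univ ×ˢ Icc (0 : ℝ) T)
  differentiable : ∀ t ∈ Icc (0 : ℝ) T, Differentiable ℝ
    (fun z : EuclideanSpace ℝ (Fin n) × EuclideanSpace ℝ (Fin m) => f z.1 z.2 t)
  continuousOn_fderiv : ContinuousOn
    (fun q : (EuclideanSpace ℝ (Fin n) × EuclideanSpace ℝ (Fin m)) × ℝ =>
      fderiv ℝ (fun z : EuclideanSpace ℝ (Fin n) × EuclideanSpace ℝ (Fin m) =>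
        f z.1 z.2 q.2) q.1)
    (univ ×ˢ Icc (0 : ℝ) T)

/-- `x` is absolutely continuous on `[0,T]`, starts at `x0`, and satisfies
`x'(t) = f (x(t), u(t), t)` for a.e. `t ∈ [0,T]`. Only the values of `x` on `[0,T]` matter. -/
structure IsTrajectory
    (f : EuclideanSpace ℝ (Fin n) → EuclideanSpace ℝ (Fin m) → ℝ → EuclideanSpace ℝ (Fin n))
    (T : ℝ) (x0 : EuclideanSpace ℝ (Fin n)) (u : Control m T)
    (x : ℝ → EuclideanSpace ℝ (Fin n)) : Prop where
  absolutelyContinuous : AbsolutelyContinuousOnInterval x 0 T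
  initial : x 0 = x0
  ode : ∀ᵐ t ∂(volume.restrict (Icc (0 : ℝ) T)), HasDerivAt x (f (x t) (u t) t) t

/-- The set of admissible controls. -/
def admissibleControls
    (f : EuclideanSpace ℝ (Fin n) → EuclideanSpace ℝ (Fin m) → ℝ → EuclideanSpace ℝ (Fin n))
    (T : ℝ) (x0 : EuclideanSpace ℝ (Fin n)) : Set (Control m T) :=
  {u | ∃ x, IsTrajectory f T x0 u x}

open Classical in
/-- The trajectory `x_u` of an admissible control `u` (the zero function if `u` is not
admissible). -/
noncomputable def trajectory
    (f : EuclideanSpace ℝ (Fin n) → EuclideanSpace ℝ (Fin m) → ℝ → EuclideanSpace ℝ (Fin n))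
    (T : ℝ) (x0 : EuclideanSpace ℝ (Fin n)) (u : Control m T) : ℝ → EuclideanSpace ℝ (Fin n) :=
  if h : ∃ x, IsTrajectory f T x0 u x then h.choose else 0

/-- The end-point mapping `E(u) = x_u(T)`, extended by zero outside the admissible controls. -/
noncomputable def endpointMap
    (f : EuclideanSpace ℝ (Fin n) → EuclideanSpace ℝ (Fin m) → ℝ → EuclideanSpace ℝ (Fin n))
    (T : ℝ) (x0 : EuclideanSpace ℝ (Fin n)) (u : Control m T) : EuclideanSpace ℝ (Fin n) :=
  trajectory f T x0 u T

/-- `L^∞([0,T], U)`: the controls with values in `U` almost everywhere. -/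
def constrainedControls (T : ℝ) (U : Set (EuclideanSpace ℝ (Fin m))) : Set (Control m T) :=
  {v | ∀ᵐ t ∂(volume.restrict (Icc (0 : ℝ) T)), v t ∈ U}

/-- The tangent cone `ℝ₊ (L^∞([0,T], U) - u)`. -/
def tangentCone (T : ℝ) (U : Set (EuclideanSpace ℝ (Fin m))) (u : Control m T) :
    Set (Control m T) :=
  {w | ∃ α : ℝ, 0 ≤ α ∧ ∃ v ∈ constrainedControls T U, w = α • (v - u)}

/-- The image of the tangent cone under the Fréchet differential of the end-point mapping is the
whole of `ℝ^n`. -/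
def IsStronglyURegular
    (f : EuclideanSpace ℝ (Fin n) → EuclideanSpace ℝ (Fin m) → ℝ → EuclideanSpace ℝ (Fin n))
    (T : ℝ) (x0 : EuclideanSpace ℝ (Fin n)) (U : Set (EuclideanSpace ℝ (Fin m)))
    (u : Control m T) : Prop :=
  (fderiv ℝ (endpointMap f T x0) u) '' tangentCone T U u = univ

/-- Weakly `U`-singular means not strongly `U`-regular. -/
def IsWeaklyUSingular
    (f : EuclideanSpace ℝ (Fin n) → EuclideanSpace ℝ (Fin m) → ℝ → EuclideanSpace ℝ (Fin n))
    (T : ℝ) (x0 : EuclideanSpace ℝ (Fin n)) (U : Set (EuclideanSpace ℝ (Fin m)))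
    (u : Control m T) : Prop :=
  ¬ IsStronglyURegular f T x0 U u

/-- The Hamiltonian `H(x, u, p, t) = ⟨p, f(x, u, t)⟩`. -/
noncomputable def hamiltonian
    (f : EuclideanSpace ℝ (Fin n) → EuclideanSpace ℝ (Fin m) → ℝ → EuclideanSpace ℝ (Fin n))
    (x : EuclideanSpace ℝ (Fin n)) (u : EuclideanSpace ℝ (Fin m))
    (p : EuclideanSpace ℝ (Fin n)) (t : ℝ) : ℝ :=
  inner ℝ p (f x u t)

/-- The normal cone to `U` at `a`. -/
def normalCone (U : Set (EuclideanSpace ℝ (Fin m))) (a : EuclideanSpace ℝ (Fin m)) :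
    Set (EuclideanSpace ℝ (Fin m)) :=
  {θ | ∀ ω ∈ U, inner ℝ θ (ω - a) ≤ 0}

/-- `(x, u, p)` is a weak `U`-extremal lift of `(x, u)`: the adjoint vector `p` is absolutely
continuous on `[0,T]` and satisfies the adjoint equation and the Hamiltonian gradient condition.
Only the values of `p` on `[0,T]` matter. -/
structure IsWeakUExtremalLift
    (f : EuclideanSpace ℝ (Fin n) → EuclideanSpace ℝ (Fin m) → ℝ → EuclideanSpace ℝ (Fin n))
    (T : ℝ) (U : Set (EuclideanSpace ℝ (Fin m))) (x : ℝ → EuclideanSpace ℝ (Fin n))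
    (u : Control m T) (p : ℝ → EuclideanSpace ℝ (Fin n)) : Prop where
  absolutelyContinuous : AbsolutelyContinuousOnInterval p 0 T
  adjoint_equation : ∀ᵐ t ∂(volume.restrict (Icc (0 : ℝ) T)),
    HasDerivAt p (-gradient (fun y => hamiltonian f y (u t) (p t) t) (x t)) t
  hamiltonian_gradient : ∀ᵐ t ∂(volume.restrict (Icc (0 : ℝ) T)),
    gradient (fun w => hamiltonian f (x t) w (p t) t) (u t) ∈ normalCone U (u t)

end ControlSystem

/-! Differentiability of the end-point map comes from the implicit function theorem. On pairs
(control, state) in L^∞ × C_b, consider the defect F(v, x) = x - x⁰ - ∫₀ᵗ f(x, v, s) ds, which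
vanishes exactly at the trajectories. Superposition operators are strictly differentiable on L^∞
(`hasStrictFDerivAt_superposition`), and ∂F/∂x is the identity minus a Volterra operator, invertible
because the powers of the latter decay factorially (`isUnit_one_sub_volterra`). Hence x_v exists for
v near u and depends differentiably on v, and DE(u)w = ξ(T), where ξ solves the linearized equation
with ξ(0) = 0.

The equivalence rests on one duality formula: if p solves the adjoint equation, then ⟨p(T), DE(u)w⟩
= ∫ ⟨∇_u H, w⟩ (`IsC1Dynamics.inner_fderiv_endpointMap`).

From (a) to (b): the image of the tangent cone is a convex cone other than ℝ^n, hence lies in a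
half-space ⟨ψ, ·⟩ ≤ 0 with ψ ≠ 0. With p(T) = ψ, the formula gives ∫ ⟨∇_u H, v - u⟩ ≤ 0 for every v
with values in U, and testing on modifications of u over measurable sets makes this pointwise
(`ae_mem_normalCone_of_integral_nonpos`).

From (b) to (a): a nontrivial p has p(T) ≠ 0 by linear uniqueness. The formula puts the image cone
in the half-space ⟨p(T), ·⟩ ≤ 0, which misses p(T). -/

namespace ControlSystem

/-- Lebesgue measure on `[0,T]`. -/
noncomputable abbrev intervalMeasure (T : ℝ) : Measure ℝ := volume.restrict (Icc (0 : ℝ) T)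

/-! ### Pointwise bounds and the L^∞ norm -/

section EssentiallyBounded

variable {E : Type*} [NormedAddCommGroup E]

theorem ae_norm_le_norm {α : Type*} [MeasurableSpace α] {μ : Measure α} (h : Lp E ⊤ μ) :
    ∀ᵐ s ∂μ, ‖h s‖ ≤ ‖h‖ := by
  have h1 := ae_le_eLpNormEssSup (f := h) (μ := μ)
  filter_upwards [h1] with s hs
  rw [Lp.norm_def, eLpNorm_exponent_top]
  have := ENNReal.toReal_mono (by simpa using Lp.eLpNorm_ne_top h) hs
  simpa using this

theorem norm_le_of_ae_norm_le {α : Type*} [MeasurableSpace α] {μ : Measure α}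
    (h : Lp E ⊤ μ) {C : ℝ} (hC : 0 ≤ C) (hb : ∀ᵐ s ∂μ, ‖h s‖ ≤ C) : ‖h‖ ≤ C := by
  rw [Lp.norm_def, eLpNorm_exponent_top]
  refine ENNReal.toReal_le_of_le_ofReal hC (eLpNormEssSup_le_of_ae_bound hb)

theorem integrable_of_memLp_top {T : ℝ} (h : Lp E ⊤ (intervalMeasure T)) :
    Integrable h (intervalMeasure T) :=
  memLp_one_iff_integrable.1 ((Lp.memLp h).mono_exponent le_top)

end EssentiallyBounded

/-! ### Primitives of essentially bounded functions -/

section Primitive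

variable {E : Type*} [NormedAddCommGroup E] [NormedSpace ℝ E]

theorem norm_integral_le_mul_abs {T : ℝ} {h : ℝ → E} {C : ℝ} (hC : 0 ≤ C)
    (hb : ∀ᵐ s ∂(intervalMeasure T), ‖h s‖ ≤ C) (a b : ℝ) :
    ‖∫ s in a..b, h s ∂(intervalMeasure T)‖ ≤ C * |b - a| := by
  rw [intervalIntegral.norm_integral_eq_norm_integral_uIoc]
  have h1 : (intervalMeasure T) (uIoc a b) ≤ volume (uIoc a b) :=
    Measure.restrict_le_self _
  have h2 : volume (uIoc a b) = ENNReal.ofReal |b - a| := by simp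
  have h3 : (intervalMeasure T) (uIoc a b) < ⊤ := by
    refine h1.trans_lt ?_
    rw [h2]; exact ENNReal.ofReal_lt_top
  refine (norm_setIntegral_le_of_norm_le_const_ae h3 (ae_restrict_of_ae hb)).trans ?_
  refine mul_le_mul_of_nonneg_left ?_ hC
  refine ENNReal.toReal_le_of_le_ofReal (abs_nonneg _) (h2 ▸ h1)

theorem continuous_integral_intervalMeasure {T : ℝ} (h : Lp E ⊤ (intervalMeasure T)) :
    Continuous fun t => ∫ s in (0 : ℝ)..t, h s ∂(intervalMeasure T) :=
  (integrable_of_memLp_top h).continuous_primitive 0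

theorem norm_integral_intervalMeasure_le {T : ℝ} (h : Lp E ⊤ (intervalMeasure T)) (t : ℝ) :
    ‖∫ s in (0 : ℝ)..t, h s ∂(intervalMeasure T)‖ ≤ ‖h‖ * (intervalMeasure T).real univ := by
  rw [intervalIntegral.norm_integral_eq_norm_integral_uIoc]
  refine (norm_setIntegral_le_of_norm_le_const_ae (measure_lt_top (intervalMeasure T) _)
    (ae_restrict_of_ae (ae_norm_le_norm h))).trans ?_
  exact mul_le_mul_of_nonneg_left (measureReal_mono (subset_univ _)) (norm_nonneg _)

/-- The primitive vanishing at `0` of an essentially bounded function on `[0,T]`, extended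
by constants to the real line. -/
noncomputable def primitive (T : ℝ) :
    Lp E ⊤ (intervalMeasure T) →L[ℝ] (BoundedContinuousFunction ℝ E) :=
  LinearMap.mkContinuous
    { toFun := fun h => BoundedContinuousFunction.ofNormedAddCommGroup
        (fun t => ∫ s in (0 : ℝ)..t, h s ∂(intervalMeasure T))
        (continuous_integral_intervalMeasure h) _ (norm_integral_intervalMeasure_le h)
      map_add' := by
        intro h k
        ext t
        simp only [BoundedContinuousFunction.coe_ofNormedAddCommGroup,
          BoundedContinuousFunction.coe_add, Pi.add_apply]
        rw [← intervalIntegral.integral_add (integrable_of_memLp_top h).intervalIntegrable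
          (integrable_of_memLp_top k).intervalIntegrable]
        refine intervalIntegral.integral_congr_ae ?_
        filter_upwards [Lp.coeFn_add h k] with s hs _ using hs
      map_smul' := by
        intro c h
        ext t
        simp only [BoundedContinuousFunction.coe_ofNormedAddCommGroup, RingHom.id_apply,
          BoundedContinuousFunction.coe_smul]
        rw [← intervalIntegral.integral_smul]
        refine intervalIntegral.integral_congr_ae ?_
        filter_upwards [Lp.coeFn_smul c h] with s hs _ using hs }
    ((intervalMeasure T).real univ) (fun h => by
      refine (BoundedContinuousFunction.norm_le (by positivity)).2 fun t => ?_
      rw [mul_comm]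
      exact norm_integral_intervalMeasure_le h t)

theorem primitive_apply {T : ℝ} (h : Lp E ⊤ (intervalMeasure T)) (t : ℝ) :
    primitive T h t = ∫ s in (0 : ℝ)..t, h s ∂(intervalMeasure T) := rfl

@[simp] theorem primitive_zero_right {T : ℝ} (h : Lp E ⊤ (intervalMeasure T)) :
    primitive T h 0 = 0 := by simp [primitive_apply]

theorem lipschitzWith_primitive {T : ℝ} (h : Lp E ⊤ (intervalMeasure T)) :
    LipschitzWith ‖h‖₊ (primitive T h) := by
  refine LipschitzWith.of_dist_le_mul fun a b => ?_
  rw [dist_eq_norm, primitive_apply, primitive_apply,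
    intervalIntegral.integral_interval_sub_left (integrable_of_memLp_top h).intervalIntegrable
      (integrable_of_memLp_top h).intervalIntegrable]
  exact norm_integral_le_mul_abs (norm_nonneg _) (ae_norm_le_norm h) b a

theorem primitive_eq_indicator {T : ℝ} (h : Lp E ⊤ (intervalMeasure T)) (t : ℝ) :
    primitive T h t = ∫ s in (0 : ℝ)..t, (Icc 0 T).indicator h s := by
  simp only [primitive_apply, intervalIntegral, intervalMeasure]
  rw [Measure.restrict_restrict measurableSet_Ioc, Measure.restrict_restrict measurableSet_Ioc,
    setIntegral_indicator measurableSet_Icc, setIntegral_indicator measurableSet_Icc]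

theorem ae_hasDerivAt_primitive [CompleteSpace E] {T : ℝ} (h : Lp E ⊤ (intervalMeasure T)) :
    ∀ᵐ t ∂(intervalMeasure T), HasDerivAt (primitive T h) (h t) t := by
  have h1 : Integrable ((Icc 0 T).indicator h) volume :=
    (integrable_indicator_iff measurableSet_Icc).2 (integrable_of_memLp_top h)
  rw [ae_restrict_iff' measurableSet_Icc]
  filter_upwards [LocallyIntegrable.ae_hasDerivAt_integral h1.locallyIntegrable] with t ht hmem
  have := ht 0
  rw [indicator_of_mem hmem] at this
  refine this.congr_of_eventuallyEq (.of_forall fun s => ?_)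
  exact primitive_eq_indicator h s

theorem absolutelyContinuousOnInterval_primitive {T : ℝ} (h : Lp E ⊤ (intervalMeasure T)) (a b : ℝ) :
    AbsolutelyContinuousOnInterval (primitive T h) a b :=
  (lipschitzWith_primitive h).lipschitzOnWith.absolutelyContinuousOnInterval

/-- An absolutely continuous function with zero derivative a.e. is constant; here it is applied to
the difference with the primitive. This converts a.e. differential equations into integral
equations. -/
theorem eq_add_primitive_of_ae_hasDerivAt [CompleteSpace E] {T : ℝ}
    {z : ℝ → E} (hz : AbsolutelyContinuousOnInterval z 0 T) (h : Lp E ⊤ (intervalMeasure T))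
    (hd : ∀ᵐ t ∂(intervalMeasure T), HasDerivAt z (h t) t) {t : ℝ} (ht : t ∈ Icc 0 T) :
    z t = z 0 + primitive T h t := by
  have hT : 0 ≤ T := ht.1.trans ht.2
  have h1 : ∀ᵐ t ∂(intervalMeasure T), HasDerivAt (fun t => z t - primitive T h t) 0 t := by
    filter_upwards [hd, ae_hasDerivAt_primitive h] with t h1 h2
    simpa using h1.fun_sub h2
  rw [ae_restrict_iff' measurableSet_Icc, ← uIcc_of_le hT] at h1
  obtain ⟨C, hC⟩ := AbsolutelyContinuousOnInterval.const_of_ae_hasDerivAt_zero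
    (hz.sub (absolutelyContinuousOnInterval_primitive h 0 T)) h1
  rw [uIcc_of_le hT] at hC
  have h2 : z t - primitive T h t = C := hC t ht
  have h3 : z 0 - primitive T h 0 = C := hC 0 ⟨le_rfl, hT⟩
  rw [primitive_zero_right, sub_zero] at h3
  rw [h3, ← h2]; abel

theorem primitive_apply_projIcc {T : ℝ} (hT : 0 ≤ T) (h : Lp E ⊤ (intervalMeasure T)) (t : ℝ) :
    primitive T h t = primitive T h (projIcc 0 T hT t) := by
  rw [← sub_eq_zero, primitive_apply, primitive_apply,
    intervalIntegral.integral_interval_sub_left (integrable_of_memLp_top h).intervalIntegrable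
      (integrable_of_memLp_top h).intervalIntegrable, intervalIntegral.intervalIntegral_eq_integral_uIoc]
  -- The interval between t and its projection meets [0,T] at most in {0}, because `uIoc` is closed
  -- on the right: (t, 0] for t < 0, and (T, t] for t > T.
  have : intervalMeasure T (uIoc (projIcc 0 T hT t : ℝ) t) = 0 := by
    rw [intervalMeasure, Measure.restrict_apply measurableSet_uIoc]
    have : uIoc (projIcc 0 T hT t : ℝ) t ∩ Icc 0 T ⊆ {0} := by
      rintro s ⟨h1, h2⟩
      rw [coe_projIcc] at h1
      simp only [mem_uIoc, mem_Icc, mem_singleton_iff] at *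
      grind
    exact measure_mono_null this (by simp)
  rw [Measure.restrict_eq_zero.2 this]
  simp

theorem norm_primitive_le_of_ae_norm_le_pow {T : ℝ} {h : Lp E ⊤ (intervalMeasure T)} {b : ℝ}
    {j : ℕ} (hb : ∀ᵐ s ∂(intervalMeasure T), ‖h s‖ ≤ b * s ^ j) {t : ℝ} (ht : t ∈ Icc 0 T) :
    ‖primitive T h t‖ ≤ b * (t ^ (j + 1) / (j + 1)) := by
  have e : primitive T h t = ∫ s in (0 : ℝ)..t, h s := by
    rw [primitive_apply, intervalIntegral.integral_of_le ht.1, intervalIntegral.integral_of_le ht.1,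
      Measure.restrict_restrict measurableSet_Ioc,
      inter_eq_self_of_subset_left (Ioc_subset_Icc_self.trans (Icc_subset_Icc_right ht.2))]
  rw [e]
  rw [ae_restrict_iff' measurableSet_Icc] at hb
  refine (intervalIntegral.norm_integral_le_of_norm_le ht.1 (g := fun s => b * s ^ j) ?_ ?_).trans ?_
  · filter_upwards [hb] with s hs hs'
    exact hs ⟨hs'.1.le, hs'.2.trans ht.2⟩
  · exact (by fun_prop : Continuous fun s : ℝ => b * s ^ j).intervalIntegrable _ _
  · simp

end Primitive

/-! ### Superposition operators on L^∞ -/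

section Superposition

variable {G F : Type*} [NormedAddCommGroup G] [NormedSpace ℝ G] [ProperSpace G]
  [NormedAddCommGroup F] [NormedSpace ℝ F]

omit [NormedSpace ℝ G] [NormedSpace ℝ F] in
theorem memLp_superposition {T : ℝ} {g : G × ℝ → F} (hg : Continuous g)
    (w : Lp G ⊤ (intervalMeasure T)) :
    MemLp (fun s => g (w s, s)) ⊤ (intervalMeasure T) := by
  have hK : IsCompact (Metric.closedBall (0 : G) ‖w‖ ×ˢ Icc (0 : ℝ) T) :=
    (isCompact_closedBall _ _).prod isCompact_Icc
  obtain ⟨C, hC⟩ := hK.exists_bound_of_continuousOn hg.continuousOn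
  refine memLp_top_of_bound
    (hg.comp_aestronglyMeasurable ((Lp.aestronglyMeasurable w).prodMk
      continuous_id.aestronglyMeasurable)) C ?_
  filter_upwards [ae_norm_le_norm w, ae_restrict_mem measurableSet_Icc] with s h1 h2
  exact hC _ ⟨by simpa using h1, h2⟩

/-- The superposition (Nemytskii) operator `w ↦ g (w(·), ·)` on essentially bounded functions. -/
noncomputable def superposition (T : ℝ) {g : G × ℝ → F} (hg : Continuous g)
    (w : Lp G ⊤ (intervalMeasure T)) : Lp F ⊤ (intervalMeasure T) :=
  (memLp_superposition hg w).toLp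

omit [NormedSpace ℝ G] [NormedSpace ℝ F] in
theorem coeFn_superposition {T : ℝ} {g : G × ℝ → F} (hg : Continuous g)
    (w : Lp G ⊤ (intervalMeasure T)) :
    superposition T hg w =ᵐ[intervalMeasure T] fun s => g (w s, s) :=
  MemLp.coeFn_toLp _

/-- Pointwise application of an essentially bounded family of continuous linear maps. -/
noncomputable def pointwiseApply {T : ℝ} (L : Lp (G →L[ℝ] F) ⊤ (intervalMeasure T)) :
    Lp G ⊤ (intervalMeasure T) →L[ℝ] Lp F ⊤ (intervalMeasure T) :=
  (ContinuousLinearMap.id ℝ (G →L[ℝ] F)).holderL (intervalMeasure T) ⊤ ⊤ ⊤ L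

omit [ProperSpace G] in
theorem coeFn_pointwiseApply {T : ℝ} (L : Lp (G →L[ℝ] F) ⊤ (intervalMeasure T))
    (w : Lp G ⊤ (intervalMeasure T)) :
    pointwiseApply L w =ᵐ[intervalMeasure T] fun s => L s (w s) :=
  (ContinuousLinearMap.id ℝ (G →L[ℝ] F)).coeFn_holder L w

/-- A ball in L^∞ takes values, almost everywhere, in one compact set, where the differential of g
is uniformly continuous. The mean value inequality applied at each time then gives a remainder
uniform in time. -/
theorem hasStrictFDerivAt_superposition {T : ℝ} {g : G × ℝ → F} (hg : Continuous g)
    (hd : ∀ t, Differentiable ℝ fun z => g (z, t))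
    (hD : Continuous fun q : G × ℝ => fderiv ℝ (fun z => g (z, q.2)) q.1)
    (w₀ : Lp G ⊤ (intervalMeasure T)) :
    HasStrictFDerivAt (superposition T hg) (pointwiseApply (superposition T hD w₀)) w₀ := by
  refine .of_isLittleO ?_
  rw [Asymptotics.isLittleO_iff]
  intro ε hε
  have hK : IsCompact (Metric.closedBall (0 : G) (‖w₀‖ + 1) ×ˢ Icc (0 : ℝ) T) :=
    (isCompact_closedBall _ _).prod isCompact_Icc
  have huc := hK.uniformContinuousOn_of_continuous hD.continuousOn
  rw [Metric.uniformContinuousOn_iff] at huc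
  obtain ⟨δ, hδ, hδ'⟩ := huc ε hε
  -- The bound 1 keeps all values in the compact set of radius ‖w₀‖ + 1; the bound δ makes the
  -- differential vary by less than ε.
  have hr : 0 < min δ 1 := lt_min hδ one_pos
  have hnhds : Metric.ball w₀ (min δ 1) ×ˢ Metric.ball w₀ (min δ 1) ∈ 𝓝 (w₀, w₀) :=
    prod_mem_nhds (Metric.ball_mem_nhds _ hr) (Metric.ball_mem_nhds _ hr)
  filter_upwards [hnhds]
  rintro ⟨w₁, w₂⟩ ⟨h₁, h₂⟩
  simp only at h₁ h₂ ⊢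
  rw [mem_ball_iff_norm] at h₁ h₂
  refine norm_le_of_ae_norm_le _ (by positivity) ?_
  filter_upwards [Lp.coeFn_sub (superposition T hg w₁ - superposition T hg w₂)
      (pointwiseApply (superposition T hD w₀) (w₁ - w₂)),
    Lp.coeFn_sub (superposition T hg w₁) (superposition T hg w₂),
    coeFn_superposition hg w₁, coeFn_superposition hg w₂, coeFn_superposition hD w₀,
    coeFn_pointwiseApply (superposition T hD w₀) (w₁ - w₂), Lp.coeFn_sub w₁ w₂,
    ae_norm_le_norm (w₁ - w₂), ae_norm_le_norm (w₁ - w₀), ae_norm_le_norm (w₂ - w₀),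
    Lp.coeFn_sub w₁ w₀, Lp.coeFn_sub w₂ w₀, ae_norm_le_norm w₀,
    ae_restrict_mem measurableSet_Icc] with s e1 e2 e3 e4 e5 e6 e7 b1 b2 b3 e8 e9 b4 hs
  rw [e1, Pi.sub_apply, e2, Pi.sub_apply, e3, e4, e6, e5, e7, Pi.sub_apply]
  rw [e7, Pi.sub_apply] at b1
  rw [e8, Pi.sub_apply] at b2
  rw [e9, Pi.sub_apply] at b3
  refine (Convex.norm_image_sub_le_of_norm_fderiv_le' (f := fun z => g (z, s))
    (s := Metric.ball (w₀ s) (min δ 1))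
    (fun z _ => hd s z) (C := ε) ?_ (convex_ball _ _) (x := w₂ s) (y := w₁ s) ?_ ?_).trans ?_
  · intro z hz
    rw [mem_ball_iff_norm] at hz
    have hz1 : ‖z‖ ≤ ‖w₀‖ + 1 := by
      calc ‖z‖ = ‖w₀ s + (z - w₀ s)‖ := by congr 1; abel
        _ ≤ ‖w₀ s‖ + ‖z - w₀ s‖ := norm_add_le _ _
        _ ≤ _ := add_le_add b4 (hz.le.trans (min_le_right _ _))
    have := hδ' (z, s) ⟨by simpa using hz1, hs⟩ (w₀ s, s)
      ⟨by simpa using b4.trans (by linarith), hs⟩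
      (by simpa [Prod.dist_eq, dist_eq_norm, hδ] using hz.trans_le (min_le_left _ _))
    rw [dist_eq_norm] at this
    exact this.le
  · rw [mem_ball_iff_norm]; exact b3.trans_lt h₂
  · rw [mem_ball_iff_norm]; exact b2.trans_lt h₁
  · gcongr

end Superposition

/-! ### Volterra operators and factorial decay -/

section Volterra

variable {E : Type*} [NormedAddCommGroup E] [NormedSpace ℝ E]

/-- A bounded continuous function regarded as an essentially bounded function on `[0,T]`. -/
noncomputable abbrev restrictLp (T : ℝ) [SecondCountableTopologyEither ℝ E] :
    BoundedContinuousFunction ℝ E →L[ℝ] Lp E ⊤ (intervalMeasure T) :=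
  BoundedContinuousFunction.toLp ⊤ (intervalMeasure T) ℝ

theorem coeFn_restrictLp {T : ℝ} (x : BoundedContinuousFunction ℝ E) :
    restrictLp T x =ᵐ[intervalMeasure T] x :=
  BoundedContinuousFunction.coeFn_toLp _ _ _ _

/-- Iterated primitives of functions dominated by the previous one decay factorially. -/
theorem norm_le_pow_div_factorial {T C : ℝ} (hC : 0 ≤ C)
    (d : ℕ → BoundedContinuousFunction ℝ E) (h : ℕ → Lp E ⊤ (intervalMeasure T))
    (hd : ∀ j, d (j + 1) = primitive T (h j))
    (hb : ∀ j, ∀ᵐ s ∂(intervalMeasure T), ‖h j s‖ ≤ C * ‖d j s‖) (j : ℕ) :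
    ∀ t ∈ Icc 0 T, ‖d j t‖ ≤ C ^ j * ‖d 0‖ * (t ^ j / j.factorial) := by
  induction j with
  | zero => intro t _; simpa using (d 0).norm_coe_le_norm t
  | succ j ih =>
    intro t ht
    rw [hd]
    have : ∀ᵐ s ∂(intervalMeasure T), ‖h j s‖ ≤ C ^ (j + 1) * ‖d 0‖ / j.factorial * s ^ j := by
      filter_upwards [hb j, ae_restrict_mem measurableSet_Icc] with s h1 h2
      calc ‖h j s‖ ≤ C * ‖d j s‖ := h1
        _ ≤ C * (C ^ j * ‖d 0‖ * (s ^ j / j.factorial)) := by gcongr; exact ih s h2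
        _ = _ := by ring
    refine (norm_primitive_le_of_ae_norm_le_pow this ht).trans (le_of_eq ?_)
    rw [Nat.factorial_succ]
    push_cast
    field_simp

theorem norm_le_mul_pow_div_factorial {T C : ℝ} (hT : 0 ≤ T) (hC : 0 ≤ C)
    (d : ℕ → BoundedContinuousFunction ℝ E) (h : ℕ → Lp E ⊤ (intervalMeasure T))
    (hd : ∀ j, d (j + 1) = primitive T (h j))
    (hb : ∀ j, ∀ᵐ s ∂(intervalMeasure T), ‖h j s‖ ≤ C * ‖d j s‖) (j : ℕ) :
    ‖d (j + 1)‖ ≤ (C * T) ^ (j + 1) / (j + 1).factorial * ‖d 0‖ := by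
  refine (BoundedContinuousFunction.norm_le (by positivity)).2 fun t => ?_
  rw [hd, primitive_apply_projIcc hT, ← hd]
  have hm := (projIcc 0 T hT t).2
  refine (norm_le_pow_div_factorial hC d h hd hb (j + 1) _ hm).trans ?_
  calc _ ≤ C ^ (j + 1) * ‖d 0‖ * (T ^ (j + 1) / (j + 1).factorial) := by
        have h0 := hm.1
        have h1 := hm.2
        gcongr
    _ = _ := by rw [mul_pow]; ring

/-- Plays the role of Grönwall's lemma: the factorial estimate for the constant sequence d reads ‖d‖
≤ (CT)^j / j! · ‖d‖, and the right side tends to 0. -/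
theorem eq_zero_of_eq_primitive {T C : ℝ} (hT : 0 ≤ T) (hC : 0 ≤ C)
    {d : BoundedContinuousFunction ℝ E} {h : Lp E ⊤ (intervalMeasure T)}
    (hd : d = primitive T h) (hb : ∀ᵐ s ∂(intervalMeasure T), ‖h s‖ ≤ C * ‖d s‖) : d = 0 := by
  have key := fun j => norm_le_mul_pow_div_factorial hT hC (fun _ => d) (fun _ => h)
    (fun _ => hd) (fun _ => hb) j
  have hlim := ((FloorSemiring.tendsto_pow_div_factorial_atTop (C * T)).comp
    (Filter.tendsto_add_atTop_nat 1)).mul_const ‖d‖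
  rw [zero_mul] at hlim
  exact norm_le_zero_iff.1 (ge_of_tendsto' hlim key)

/-- The Volterra operator `x ↦ ∫₀ᵗ L(s) x(s) ds`. -/
noncomputable def volterra {T : ℝ} (L : Lp (E →L[ℝ] E) ⊤ (intervalMeasure T)) :
    BoundedContinuousFunction ℝ E →L[ℝ] BoundedContinuousFunction ℝ E :=
  primitive T ∘L pointwiseApply L ∘L restrictLp T

/-- The operator K itself need not be a contraction, but some power K^(j+1) has norm below 1, so 1 -
K^(j+1) is invertible. It is the product of 1 - K and a commuting geometric sum, so 1 - K is
invertible too. -/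
theorem isUnit_one_sub_volterra [CompleteSpace E] {T : ℝ} (hT : 0 ≤ T)
    (L : Lp (E →L[ℝ] E) ⊤ (intervalMeasure T)) : IsUnit (1 - volterra L) := by
  have key : ∀ j : ℕ, ‖volterra L ^ (j + 1)‖ ≤ (‖L‖ * T) ^ (j + 1) / (j + 1).factorial := by
    intro j
    refine ContinuousLinearMap.opNorm_le_bound _ (by positivity) fun x => ?_
    have := norm_le_mul_pow_div_factorial hT (norm_nonneg L) (fun j => (volterra L ^ j) x)
      (fun j => pointwiseApply L (restrictLp T ((volterra L ^ j) x)))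
      (fun j => by simp only [pow_succ']; rfl) (fun j => by
        filter_upwards [coeFn_pointwiseApply L (restrictLp T ((volterra L ^ j) x)),
          coeFn_restrictLp (T := T) ((volterra L ^ j) x), ae_norm_le_norm L] with s h1 h2 h3
        rw [h1, h2]
        exact (L s).le_of_opNorm_le h3 _) j
    simpa using this
  have hlim := (FloorSemiring.tendsto_pow_div_factorial_atTop (‖L‖ * T)).comp
    (Filter.tendsto_add_atTop_nat 1)
  obtain ⟨j, hj⟩ := (hlim.eventually_lt_const one_pos).exists
  have h1 : IsUnit (1 - volterra L ^ (j + 1)) :=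
    isUnit_one_sub_of_norm_lt_one ((key j).trans_lt hj)
  rw [← mul_neg_geom_sum] at h1
  have hcomm : Commute (1 - volterra L) (∑ i ∈ Finset.range (j + 1), volterra L ^ i) :=
    (mul_neg_geom_sum _ _).trans (geom_sum_mul_neg _ _).symm
  exact (hcomm.isUnit_mul_iff.1 h1).1

end Volterra

/-! ### The integral equation and its implicit solution -/

section EndpointEquation

variable {E V : Type*} [NormedAddCommGroup E] [NormedSpace ℝ E] [ProperSpace E]
  [NormedAddCommGroup V] [NormedSpace ℝ V] [ProperSpace V]

/-- The essentially bounded function `s ↦ (x s, v s)` attached to a pair `(v, x)`. -/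
noncomputable def stateControl (T : ℝ) :
    Lp V ⊤ (intervalMeasure T) × BoundedContinuousFunction ℝ E →L[ℝ]
      Lp (E × V) ⊤ (intervalMeasure T) :=
  (ContinuousLinearMap.inr ℝ E V).compLpL ⊤ (intervalMeasure T) ∘L ContinuousLinearMap.fst ℝ _ _ +
  (ContinuousLinearMap.inl ℝ E V).compLpL ⊤ (intervalMeasure T) ∘L restrictLp T ∘L
    ContinuousLinearMap.snd ℝ _ _

omit [ProperSpace V] in
theorem coeFn_stateControl {T : ℝ} (v : Lp V ⊤ (intervalMeasure T))
    (x : BoundedContinuousFunction ℝ E) :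
    stateControl T (v, x) =ᵐ[intervalMeasure T] fun s => (x s, v s) := by
  filter_upwards [Lp.coeFn_add ((ContinuousLinearMap.inr ℝ E V).compLpL ⊤ (intervalMeasure T) v)
      ((ContinuousLinearMap.inl ℝ E V).compLpL ⊤ (intervalMeasure T) (restrictLp T x)),
    (ContinuousLinearMap.inr ℝ E V).coeFn_compLpL v,
    (ContinuousLinearMap.inl ℝ E V).coeFn_compLpL (restrictLp T x),
    coeFn_restrictLp (T := T) x] with s h1 h2 h3 h4
  simp only [stateControl, add_apply, ContinuousLinearMap.comp_apply,
    ContinuousLinearMap.coe_fst', ContinuousLinearMap.coe_snd']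
  rw [h1, Pi.add_apply, h2, h3, h4]
  simp

variable {g : (E × V) × ℝ → E}

/-- The defect of `x` as a solution of the integral equation
`x(t) = x₀ + ∫₀ᵗ g (x(s), v(s), s) ds`. -/
noncomputable def integralDefect (T : ℝ) (hg : Continuous g) (x₀ : E)
    (p : Lp V ⊤ (intervalMeasure T) × BoundedContinuousFunction ℝ E) :
    BoundedContinuousFunction ℝ E :=
  p.2 - BoundedContinuousFunction.const ℝ x₀ - primitive T (superposition T hg (stateControl T p))

theorem integralDefect_eq_zero_iff {T : ℝ} (hg : Continuous g) (x₀ : E)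
    (v : Lp V ⊤ (intervalMeasure T)) (x : BoundedContinuousFunction ℝ E) :
    integralDefect T hg x₀ (v, x) = 0 ↔
      x = BoundedContinuousFunction.const ℝ x₀ +
        primitive T (superposition T hg (stateControl T (v, x))) := by
  rw [integralDefect, sub_sub, sub_eq_zero]

theorem hasStrictFDerivAt_integralDefect {T : ℝ} (hg : Continuous g)
    (hd : ∀ t, Differentiable ℝ fun z => g (z, t))
    (hD : Continuous fun q : (E × V) × ℝ => fderiv ℝ (fun z => g (z, q.2)) q.1) (x₀ : E)
    (p : Lp V ⊤ (intervalMeasure T) × BoundedContinuousFunction ℝ E) :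
    HasStrictFDerivAt (integralDefect T hg x₀)
      (ContinuousLinearMap.snd ℝ _ _ - primitive T ∘L
        pointwiseApply (superposition T hD (stateControl T p)) ∘L stateControl T) p := by
  have h1 := (hasStrictFDerivAt_superposition hg hd hD (stateControl T p)).comp p
    (stateControl (E := E) (V := V) T).hasStrictFDerivAt
  have h2 := (primitive (E := E) T).hasStrictFDerivAt.comp p h1
  exact (hasStrictFDerivAt_snd.sub_const _).sub h2

/-- Both solutions and the control are bounded, so g is Lipschitz on a ball containing their values,
and the difference of the solutions satisfies the Grönwall-type estimate. -/
theorem integralDefect_unique {T : ℝ} (hT : 0 ≤ T) (hg : Continuous g)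
    (hd : ∀ t, Differentiable ℝ fun z => g (z, t))
    (hD : Continuous fun q : (E × V) × ℝ => fderiv ℝ (fun z => g (z, q.2)) q.1) {x₀ : E}
    {v : Lp V ⊤ (intervalMeasure T)} {x y : BoundedContinuousFunction ℝ E}
    (hx : integralDefect T hg x₀ (v, x) = 0) (hy : integralDefect T hg x₀ (v, y) = 0) : x = y := by
  rw [integralDefect_eq_zero_iff] at hx hy
  set N := superposition T hg (stateControl T (v, x)) with hN
  set M := superposition T hg (stateControl T (v, y)) with hM
  have hxy : x - y = primitive T (N - M) := by
    rw [map_sub]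
    nth_rewrite 1 [hx]
    nth_rewrite 1 [hy]
    abel
  set R := max (max ‖x‖ ‖y‖) ‖v‖
  have hK : IsCompact (Metric.closedBall (0 : E × V) R ×ˢ Icc (0 : ℝ) T) :=
    (isCompact_closedBall _ _).prod isCompact_Icc
  obtain ⟨C, hC⟩ := hK.exists_bound_of_continuousOn hD.continuousOn
  rw [← sub_eq_zero]
  refine eq_zero_of_eq_primitive hT (le_max_right C 0) hxy ?_
  filter_upwards [Lp.coeFn_sub N M, coeFn_superposition hg (stateControl T (v, x)),
    coeFn_superposition hg (stateControl T (v, y)), coeFn_stateControl v x,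
    coeFn_stateControl v y, ae_norm_le_norm v, ae_restrict_mem measurableSet_Icc]
    with s e1 e2 e3 e4 e5 b1 hs
  rw [e1, Pi.sub_apply, e2, e3, e4, e5]
  have hxs := x.norm_coe_le_norm s
  have hys := y.norm_coe_le_norm s
  refine ((convex_closedBall (0 : E × V) R).norm_image_sub_le_of_norm_fderiv_le (𝕜 := ℝ)
    (f := fun z => g (z, s)) (C := max C 0) (fun z _ => hd s z)
    (fun z hz => (hC (z, s) ⟨hz, hs⟩).trans (le_max_left _ _))
    (x := (y s, v s)) (y := (x s, v s)) ?_ ?_).trans (le_of_eq ?_)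
  · simp only [mem_closedBall_zero_iff, Prod.norm_def, R]; grind
  · simp only [mem_closedBall_zero_iff, Prod.norm_def, R]; grind
  · simp [Prod.norm_def]

/-- The partial differential with respect to the state. -/
noncomputable def fderivState (g : (E × V) × ℝ → E) (q : (E × V) × ℝ) : E →L[ℝ] E :=
  fderiv ℝ (fun z => g (z, q.2)) q.1 ∘L ContinuousLinearMap.inl ℝ E V

omit [ProperSpace E] [ProperSpace V] in
theorem continuous_fderivState (g : (E × V) × ℝ → E)
    (hD : Continuous fun q : (E × V) × ℝ => fderiv ℝ (fun z => g (z, q.2)) q.1) :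
    Continuous (fderivState g) :=
  hD.clm_comp continuous_const

theorem pointwiseApply_stateControl {T : ℝ}
    (hD : Continuous fun q : (E × V) × ℝ => fderiv ℝ (fun z => g (z, q.2)) q.1)
    (w : Lp (E × V) ⊤ (intervalMeasure T)) (x : BoundedContinuousFunction ℝ E) :
    pointwiseApply (superposition T hD w) (stateControl T (0, x)) =
      pointwiseApply (superposition T (continuous_fderivState g hD) w) (restrictLp T x) := by
  refine Lp.ext ?_
  filter_upwards [coeFn_pointwiseApply (superposition T hD w) (stateControl T (0, x)),
    coeFn_pointwiseApply (superposition T (continuous_fderivState g hD) w) (restrictLp T x),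
    coeFn_superposition hD w, coeFn_superposition (continuous_fderivState g hD) w,
    coeFn_stateControl (T := T) (0 : Lp V ⊤ (intervalMeasure T)) x, coeFn_restrictLp (T := T) x,
    Lp.coeFn_zero V ⊤ (intervalMeasure T)] with s h1 h2 h3 h4 h5 h6 h7
  rw [h1, h2, h3, h4, h5, h6, h7]
  simp [fderivState]

/-- Near a solution of the integral equation, solutions exist and depend differentiably on the
control; the differential is given by the linearized equation. -/
theorem exists_hasStrictFDerivAt_solution {T : ℝ} (hT : 0 ≤ T) (hg : Continuous g)
    (hd : ∀ t, Differentiable ℝ fun z => g (z, t))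
    (hD : Continuous fun q : (E × V) × ℝ => fderiv ℝ (fun z => g (z, q.2)) q.1) {x₀ : E}
    {u : Lp V ⊤ (intervalMeasure T)} {x : BoundedContinuousFunction ℝ E}
    (hx : integralDefect T hg x₀ (u, x) = 0) :
    ∃ (φ : Lp V ⊤ (intervalMeasure T) → BoundedContinuousFunction ℝ E)
      (φ' : Lp V ⊤ (intervalMeasure T) →L[ℝ] BoundedContinuousFunction ℝ E),
      HasStrictFDerivAt φ φ' u ∧ (∀ᶠ v in 𝓝 u, integralDefect T hg x₀ (v, φ v) = 0) ∧
      ∀ w, φ' w = primitive T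
        (pointwiseApply (superposition T hD (stateControl T (u, x))) (stateControl T (w, φ' w))) := by
  have hF := hasStrictFDerivAt_integralDefect hg hd hD x₀ (u, x)
  set D := superposition T hD (stateControl T (u, x)) with hDdef
  set F' : Lp V ⊤ (intervalMeasure T) × BoundedContinuousFunction ℝ E →L[ℝ]
    BoundedContinuousFunction ℝ E := ContinuousLinearMap.snd ℝ _ _ - primitive T ∘L
      pointwiseApply D ∘L stateControl T with hF'
  -- The partial differential in the state; its invertibility is the hypothesis of the implicit
  -- function theorem.
  have hinr : F' ∘L ContinuousLinearMap.inr ℝ _ _ =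
      1 - volterra (superposition T (continuous_fderivState g hD) (stateControl T (u, x))) := by
    refine ContinuousLinearMap.ext fun y => ?_
    have := congrArg (primitive T) (pointwiseApply_stateControl hD (stateControl T (u, x)) y)
    simpa [hF', volterra] using this
  have hinv : (F' ∘L ContinuousLinearMap.inr ℝ _ _).IsInvertible := by
    rw [hinr]
    obtain ⟨e, he⟩ := isUnit_one_sub_volterra hT
      (superposition T (continuous_fderivState g hD) (stateControl T (u, x)))
    exact ⟨ContinuousLinearEquiv.unitsEquiv ℝ _ e, by rw [← he]; rfl⟩
  refine ⟨hF.implicitFunctionOfProdDomain hinv, _,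
    hF.hasStrictFDerivAt_implicitFunctionOfProdDomain hinv, ?_, fun w => ?_⟩
  · filter_upwards [hF.eventually_apply_implicitFunctionOfProdDomain hinv] with v hv
    rw [hv, hx]
  -- Here y = -(∂F/∂x)⁻¹ (∂F/∂v) w, so F'(w, y) = 0, which is the linearized equation.
  · set y := (-(F' ∘L ContinuousLinearMap.inr ℝ _ _).inverse ∘L
      (F' ∘L ContinuousLinearMap.inl ℝ _ _)) w with hy
    have h1 : (F' ∘L ContinuousLinearMap.inr ℝ _ _) y = - F' (w, 0) := by
      have : y = - (F' ∘L ContinuousLinearMap.inr ℝ _ _).inverse (F' (w, 0)) := by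
        rw [hy]; simp
      rw [this, map_neg, hinv.self_apply_inverse]
    have h2 : F' (w, y) = 0 := by
      have h3 : (w, y) = (w, 0) + (0, y) := by simp
      rw [h3, map_add]
      change F' (w, 0) + (F' ∘L ContinuousLinearMap.inr ℝ _ _) y = 0
      rw [h1]; abel
    rw [hF'] at h2
    simpa [sub_eq_zero] using h2

end EndpointEquation

/-! ### Linear differential equations -/

section LinearEquation

variable {E : Type*} [NormedAddCommGroup E] [NormedSpace ℝ E] [CompleteSpace E]
  [SecondCountableTopologyEither ℝ E]

omit [CompleteSpace E] [SecondCountableTopologyEither ℝ E] in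
theorem primitive_apply_right {T : ℝ} (hT : 0 ≤ T) (h : Lp E ⊤ (intervalMeasure T)) :
    primitive T h T = ∫ s, h s ∂(intervalMeasure T) := by
  rw [primitive_apply, intervalIntegral.integral_of_le hT,
    Measure.restrict_restrict measurableSet_Ioc,
    inter_eq_self_of_subset_left Ioc_subset_Icc_self, integral_Icc_eq_integral_Ioc]

/-- Existence for linear differential equations with essentially bounded coefficients. -/
theorem exists_linear_solution {T : ℝ} (hT : 0 ≤ T) (L : Lp (E →L[ℝ] E) ⊤ (intervalMeasure T)) :
    ∃ S : E →ₗ[ℝ] BoundedContinuousFunction ℝ E, ∀ q,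
      S q = BoundedContinuousFunction.const ℝ q +
        primitive T (pointwiseApply L (restrictLp T (S q))) := by
  obtain ⟨e, he⟩ := isUnit_one_sub_volterra hT L
  let R : BoundedContinuousFunction ℝ E →L[ℝ] BoundedContinuousFunction ℝ E := ↑e⁻¹
  refine ⟨{ toFun := fun q => R (BoundedContinuousFunction.const ℝ q)
            map_add' := fun a b => ?_
            map_smul' := fun c a => ?_ }, fun q => ?_⟩
  · rw [← map_add]; rfl
  · rw [RingHom.id_apply, ← map_smul]; rfl
  · change R (BoundedContinuousFunction.const ℝ q) = BoundedContinuousFunction.const ℝ q +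
      volterra L (R (BoundedContinuousFunction.const ℝ q))
    set z := R (BoundedContinuousFunction.const ℝ q) with hz
    have h1 : (1 - volterra L) z = BoundedContinuousFunction.const ℝ q := by
      rw [← he, hz, ← mul_apply_eq_comp, e.mul_inv]; rfl
    rw [← h1]
    simp

omit [CompleteSpace E] in
theorem linear_solution_eq_zero {T : ℝ} (hT : 0 ≤ T) {L : Lp (E →L[ℝ] E) ⊤ (intervalMeasure T)}
    {p : BoundedContinuousFunction ℝ E}
    (hp : p = primitive T (pointwiseApply L (restrictLp T p))) : p = 0 := by
  refine eq_zero_of_eq_primitive hT (norm_nonneg L) hp ?_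
  filter_upwards [coeFn_pointwiseApply L (restrictLp T p), coeFn_restrictLp (T := T) p,
    ae_norm_le_norm L] with s h1 h2 h3
  rw [h1, h2]
  exact (L s).le_of_opNorm_le h3 _

end LinearEquation

/-! ### Adjoint equation and duality -/

section Pairing

variable {E : Type*} [NormedAddCommGroup E] [InnerProductSpace ℝ E] [FiniteDimensional ℝ E]

/-- Integration by parts: ⟨p, y⟩ is Lipschitz, hence absolutely continuous, and its derivative is
given a.e. by the product rule. -/
theorem inner_sub_inner_eq_integral {T : ℝ} (hT : 0 ≤ T) {p y : BoundedContinuousFunction ℝ E}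
    {q c : E} {h k : Lp E ⊤ (intervalMeasure T)}
    (hp : p = BoundedContinuousFunction.const ℝ q + primitive T h)
    (hy : y = BoundedContinuousFunction.const ℝ c + primitive T k) :
    inner ℝ (p T) (y T) - inner ℝ q c =
      ∫ s, (inner ℝ (p s) (k s) + inner ℝ (h s) (y s)) ∂(intervalMeasure T) := by
  have hlip : ∀ (z : BoundedContinuousFunction ℝ E) (a : E) (l : Lp E ⊤ (intervalMeasure T)),
      z = BoundedContinuousFunction.const ℝ a + primitive T l → ∀ s t,
        ‖z s - z t‖ ≤ ‖l‖ * |s - t| := by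
    rintro z a l rfl s t
    simpa [dist_eq_norm] using (lipschitzWith_primitive l).dist_le_mul s t
  have hder : ∀ (z : BoundedContinuousFunction ℝ E) (a : E) (l : Lp E ⊤ (intervalMeasure T)),
      z = BoundedContinuousFunction.const ℝ a + primitive T l →
        ∀ᵐ s ∂(intervalMeasure T), HasDerivAt z (l s) s := by
    rintro z a l rfl
    filter_upwards [ae_hasDerivAt_primitive l] with s hs
    exact hs.const_add a
  have hac : AbsolutelyContinuousOnInterval (fun t => (inner ℝ (p t) (y t) : ℝ)) 0 T := by
    refine LipschitzOnWith.absolutelyContinuousOnInterval (K := ‖p‖₊ * ‖k‖₊ + ‖h‖₊ * ‖y‖₊)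
      (LipschitzWith.of_dist_le_mul fun s t => ?_).lipschitzOnWith
    have e : inner ℝ (p s) (y s) - inner ℝ (p t) (y t) =
        inner ℝ (p s) (y s - y t) + inner ℝ (p s - p t) (y t) := by
      rw [inner_sub_right, inner_sub_left]; ring
    rw [Real.dist_eq, e, Real.dist_eq]
    push_cast
    calc |inner ℝ (p s) (y s - y t) + inner ℝ (p s - p t) (y t)|
        ≤ ‖p s‖ * ‖y s - y t‖ + ‖p s - p t‖ * ‖y t‖ :=
          (abs_add_le _ _).trans (add_le_add (abs_real_inner_le_norm _ _)
            (abs_real_inner_le_norm _ _))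
      _ ≤ ‖p‖ * (‖k‖ * |s - t|) + (‖h‖ * |s - t|) * ‖y‖ := by
          gcongr
          · exact p.norm_coe_le_norm s
          · exact hlip y c k hy s t
          · exact hlip p q h hp s t
          · exact y.norm_coe_le_norm t
      _ = _ := by ring
  have hmem : MemLp (fun s => (inner ℝ (p s) (k s) + inner ℝ (h s) (y s) : ℝ)) ⊤
      (intervalMeasure T) := by
    refine memLp_top_of_bound ?_ (‖p‖ * ‖k‖ + ‖h‖ * ‖y‖) ?_
    · exact (p.continuous.aestronglyMeasurable.inner (Lp.aestronglyMeasurable k)).add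
        ((Lp.aestronglyMeasurable h).inner y.continuous.aestronglyMeasurable)
    · filter_upwards [ae_norm_le_norm h, ae_norm_le_norm k] with s h1 h2
      refine (norm_add_le _ _).trans (add_le_add ((norm_inner_le_norm _ _).trans ?_)
        ((norm_inner_le_norm _ _).trans ?_))
      · gcongr; exact p.norm_coe_le_norm s
      · gcongr; exact y.norm_coe_le_norm s
  have key := eq_add_primitive_of_ae_hasDerivAt hac hmem.toLp (by
    filter_upwards [hder p q h hp, hder y c k hy, hmem.coeFn_toLp] with s h1 h2 h3
    rw [h3]
    exact h1.inner ℝ h2) (t := T) ⟨hT, le_rfl⟩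
  rw [primitive_apply_right hT, integral_congr_ae hmem.coeFn_toLp] at key
  have hp0 : p 0 = q := by rw [hp]; simp
  have hy0 : y 0 = c := by rw [hy]; simp
  simp only [hp0, hy0] at key
  rw [key]; ring

/-- A solution of the adjoint linear equation vanishing at the final time starts at zero. -/
theorem adjoint_initial_eq_zero {T : ℝ} (hT : 0 ≤ T)
    {A P : Lp (E →L[ℝ] E) ⊤ (intervalMeasure T)}
    (hAP : ∀ᵐ s ∂(intervalMeasure T), P s = -(A s).adjoint)
    {p : BoundedContinuousFunction ℝ E} {q : E}
    (hp : p = BoundedContinuousFunction.const ℝ q +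
      primitive T (pointwiseApply P (restrictLp T p))) (hpT : p T = 0) : q = 0 := by
  -- Solve the primal equation from the same initial value q. The pairing ⟨p, S q⟩ is constant in
  -- time, so p(T) = 0 forces ⟨q, q⟩ = 0.
  obtain ⟨S, hS⟩ := exists_linear_solution hT A
  have key := inner_sub_inner_eq_integral hT hp (hS q)
  rw [integral_eq_zero_of_ae] at key
  · rw [hpT, inner_zero_left, zero_sub, neg_eq_zero] at key
    exact inner_self_eq_zero.1 key
  · filter_upwards [hAP, coeFn_pointwiseApply P (restrictLp T p), coeFn_restrictLp (T := T) p,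
      coeFn_pointwiseApply A (restrictLp T (S q)), coeFn_restrictLp (T := T) (S q)]
      with s h1 h2 h3 h4 h5
    rw [h2, h4, h3, h5, h1]
    simp [ContinuousLinearMap.adjoint_inner_left]

/-- A terminal value is prescribed without reversing time: the map from initial to final value is a
linear endomorphism of a finite-dimensional space, injective by `adjoint_initial_eq_zero`, hence
surjective. -/
theorem exists_adjoint_solution {T : ℝ} (hT : 0 ≤ T)
    {A P : Lp (E →L[ℝ] E) ⊤ (intervalMeasure T)}
    (hAP : ∀ᵐ s ∂(intervalMeasure T), P s = -(A s).adjoint) (ψ : E) :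
    ∃ (p : BoundedContinuousFunction ℝ E) (q : E), p T = ψ ∧
      p = BoundedContinuousFunction.const ℝ q +
        primitive T (pointwiseApply P (restrictLp T p)) := by
  obtain ⟨S, hS⟩ := exists_linear_solution hT P
  let Φ : E →ₗ[ℝ] E :=
    { toFun := fun q => S q T
      map_add' := fun a b => by rw [map_add]; rfl
      map_smul' := fun c a => by rw [map_smul]; rfl }
  have hinj : Function.Injective Φ :=
    (injective_iff_map_eq_zero Φ).2 fun q hq => adjoint_initial_eq_zero hT hAP (hS q) hq
  obtain ⟨q, hq⟩ := LinearMap.injective_iff_surjective.1 hinj ψ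
  exact ⟨S q, q, hq, hS q⟩

variable {V : Type*} [NormedAddCommGroup V] [InnerProductSpace ℝ V] [FiniteDimensional ℝ V]

/-- Duality between the linearized control equation and the adjoint equation. -/
theorem inner_linearized_eq_integral {T : ℝ} (hT : 0 ≤ T)
    {D : Lp (E × V →L[ℝ] E) ⊤ (intervalMeasure T)} {P : Lp (E →L[ℝ] E) ⊤ (intervalMeasure T)}
    (hDP : ∀ᵐ s ∂(intervalMeasure T),
      P s = -(D s ∘L ContinuousLinearMap.inl ℝ E V).adjoint)
    {p y : BoundedContinuousFunction ℝ E} {q : E} {w : Lp V ⊤ (intervalMeasure T)}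
    (hp : p = BoundedContinuousFunction.const ℝ q +
      primitive T (pointwiseApply P (restrictLp T p)))
    (hy : y = primitive T (pointwiseApply D (stateControl T (w, y)))) :
    inner ℝ (p T) (y T) =
      ∫ s, inner ℝ ((D s ∘L ContinuousLinearMap.inr ℝ E V).adjoint (p s)) (w s)
        ∂(intervalMeasure T) := by
  have hy' : y = BoundedContinuousFunction.const ℝ (0 : E) +
      primitive T (pointwiseApply D (stateControl T (w, y))) := by
    have : BoundedContinuousFunction.const ℝ (0 : E) = 0 := rfl
    rw [this, zero_add]; exact hy
  have key := inner_sub_inner_eq_integral hT hp hy'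
  rw [inner_zero_right, sub_zero] at key
  rw [key]
  refine integral_congr_ae ?_
  filter_upwards [hDP, coeFn_pointwiseApply P (restrictLp T p), coeFn_restrictLp (T := T) p,
    coeFn_pointwiseApply D (stateControl T (w, y)), coeFn_stateControl w y] with s h1 h2 h3 h4 h5
  have e : D s (y s, w s) = D s (y s, 0) + D s (0, w s) := by rw [← map_add]; simp
  simp only [h2, h3, h4, h5, h1, e]
  simp [ContinuousLinearMap.adjoint_inner_left, inner_add_right]

end Pairing

/-! ### Separation of convex cones in finite dimension -/

section Cone

variable {E : Type*} [NormedAddCommGroup E] [InnerProductSpace ℝ E] [FiniteDimensional ℝ E]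

/-- If C has interior, Hahn–Banach separates the interior from a point outside C, and homogeneity
lowers the bound to 0. Otherwise C spans a proper subspace, on which some nonzero functional
vanishes. Closedness of C is not needed. -/
theorem exists_linearMap_nonpos_of_convex_cone_ne_univ {C : Set E} (hC : Convex ℝ C)
    (h0 : (0 : E) ∈ C) (hs : ∀ a : ℝ, 0 ≤ a → ∀ z ∈ C, a • z ∈ C) (hne : C ≠ univ) :
    ∃ f : E →ₗ[ℝ] ℝ, f ≠ 0 ∧ ∀ z ∈ C, f z ≤ 0 := by
  by_cases hint : (interior C).Nonempty
  · obtain ⟨x, hx⟩ := (ne_univ_iff_exists_notMem C).1 hne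
    obtain ⟨f, hf⟩ := geometric_hahn_banach_open_point hC.interior isOpen_interior
      (fun h => hx (interior_subset h))
    have hle : ∀ z ∈ C, f z ≤ f x := by
      intro z hz
      have hz' : z ∈ closure (interior C) := by
        rw [hC.closure_interior_eq_closure_of_nonempty_interior hint]
        exact subset_closure hz
      exact closure_minimal (fun a ha => (hf a ha).le)
        (isClosed_le f.continuous continuous_const) hz'
    refine ⟨f.toLinearMap, fun h => ?_, fun z hz => ?_⟩
    · obtain ⟨a, ha⟩ := hint
      have h1 := hf a ha
      have h2 : ∀ b, f b = 0 := fun b => LinearMap.congr_fun h b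
      rw [h2, h2] at h1
      exact lt_irrefl _ h1
    · by_contra! hpos
      change 0 < f z at hpos
      have hx0 : 0 ≤ f x := by simpa using hle 0 h0
      -- The multiple of z at which f takes the value f x + 1, above its supposed bound f x on C.
      have h1 := hle _ (hs ((f x + 1) / f z) (by positivity) z hz)
      rw [map_smul, smul_eq_mul, div_mul_cancel₀ _ hpos.ne'] at h1
      linarith
  · have hspan : Submodule.span ℝ C < ⊤ := by
      rw [lt_top_iff_ne_top]
      intro h
      refine hint (hC.interior_nonempty_iff_affineSpan_eq_top.2 ?_)
      rw [← AffineSubspace.direction_eq_top_iff_of_nonempty ⟨0, subset_affineSpan ℝ C h0⟩,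
        direction_affineSpan, eq_top_iff, ← h, Submodule.span_le]
      intro z hz
      simpa using vsub_mem_vectorSpan ℝ hz h0
    obtain ⟨f, hf0, hf⟩ := Submodule.exists_le_ker_of_lt_top _ hspan
    exact ⟨f, hf0, fun z hz => le_of_eq (hf (Submodule.subset_span hz))⟩

/-- A convex cone different from the whole finite-dimensional space lies in a half-space. -/
theorem exists_inner_nonpos_of_convex_cone_ne_univ {C : Set E} (hC : Convex ℝ C)
    (h0 : (0 : E) ∈ C) (hs : ∀ a : ℝ, 0 ≤ a → ∀ z ∈ C, a • z ∈ C) (hne : C ≠ univ) :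
    ∃ ψ : E, ψ ≠ 0 ∧ ∀ z ∈ C, inner ℝ ψ z ≤ 0 := by
  obtain ⟨f, hf0, hf⟩ := exists_linearMap_nonpos_of_convex_cone_ne_univ hC h0 hs hne
  have hin : ∀ z, inner ℝ ((InnerProductSpace.toDual ℝ E).symm f.toContinuousLinearMap) z = f z :=
    fun z => by simp
  refine ⟨(InnerProductSpace.toDual ℝ E).symm f.toContinuousLinearMap, fun h => hf0 ?_,
    fun z hz => (hin z).trans_le (hf z hz)⟩
  ext z
  rw [← hin, h, inner_zero_left]; rfl

end Cone

/-! ### Tangent cone and pointwise normality -/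

section ConstrainedControls

variable {m : ℕ} {T : ℝ} {U : Set (EuclideanSpace ℝ (Fin m))} {u : Control m T}

theorem convex_constrainedControls (hU : Convex ℝ U) :
    Convex ℝ (constrainedControls T U : Set (Control m T)) := by
  intro v hv w hw a b ha hb hab
  have hv' : ∀ᵐ t ∂(volume.restrict (Icc (0 : ℝ) T)), v t ∈ U := hv
  have hw' : ∀ᵐ t ∂(volume.restrict (Icc (0 : ℝ) T)), w t ∈ U := hw
  change ∀ᵐ t ∂(volume.restrict (Icc (0 : ℝ) T)), (a • v + b • w : Control m T) t ∈ U
  filter_upwards [hv', hw', Lp.coeFn_add (a • v) (b • w), Lp.coeFn_smul a v, Lp.coeFn_smul b w]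
    with t h1 h2 h3 h4 h5
  rw [h3, Pi.add_apply, h4, h5]
  exact hU h1 h2 ha hb hab

theorem zero_mem_tangentCone (hu : u ∈ constrainedControls T U) :
    (0 : Control m T) ∈ tangentCone T U u :=
  ⟨0, le_rfl, u, hu, by simp⟩

theorem smul_mem_tangentCone {w : Control m T} (hw : w ∈ tangentCone T U u) {a : ℝ}
    (ha : 0 ≤ a) : a • w ∈ tangentCone T U u := by
  obtain ⟨α, hα, v, hv, rfl⟩ := hw
  exact ⟨a * α, mul_nonneg ha hα, v, hv, smul_smul _ _ _⟩

/-- For c + d > 0, c(v - u) + d(w - u) is c + d times (v̄ - u), where v̄ is the average of v and w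
with weights c/(c + d) and d/(c + d). -/
theorem convex_tangentCone (hU : Convex ℝ U) (hu : u ∈ constrainedControls T U) :
    Convex ℝ (tangentCone T U u) := by
  rintro _ ⟨α, hα, v, hv, rfl⟩ _ ⟨β, hβ, w, hw, rfl⟩ a b ha hb -
  have hα' : 0 ≤ a * α := mul_nonneg ha hα
  have hβ' : 0 ≤ b * β := mul_nonneg hb hβ
  rcases (add_nonneg hα' hβ').eq_or_lt with h | h
  · have h1 : a * α = 0 := by linarith
    have h2 : b * β = 0 := by linarith
    rw [smul_smul, smul_smul, h1, h2]
    simpa using zero_mem_tangentCone hu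
  · refine ⟨a * α + b * β, h.le, _, convex_constrainedControls hU hv hw
      (div_nonneg hα' h.le) (div_nonneg hβ' h.le) (by rw [← add_div, div_self h.ne']), ?_⟩
    have e : ∀ x y : Control m T, ∀ c d : ℝ, 0 < c + d →
        c • x + d • y = (c + d) • ((c / (c + d)) • x + (d / (c + d)) • y) := by
      intro x y c d hcd
      rw [smul_add, smul_smul, smul_smul, mul_div_cancel₀ _ hcd.ne', mul_div_cancel₀ _ hcd.ne']
    rw [smul_sub (a * α + b * β), ← e _ _ _ _ h]
    module

/-- Pointwise form of a variational inequality for controls with values in `U`. -/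
theorem ae_mem_normalCone_of_integral_nonpos {b : ℝ → EuclideanSpace ℝ (Fin m)}
    (hb : MemLp b ⊤ (intervalMeasure T)) (hu : u ∈ constrainedControls T U)
    (h : ∀ v ∈ constrainedControls T U,
      ∫ s, inner ℝ (b s) ((v - u : Control m T) s) ∂(intervalMeasure T) ≤ 0) :
    ∀ᵐ s ∂(intervalMeasure T), b s ∈ normalCone U (u s) := by
  -- A countable dense D ⊆ U lets the exceptional null sets, one for each ω, be united; closedness
  -- of the inequality in ω then extends it to U.
  obtain ⟨D, hDU, hDc, hD⟩ :=
    (TopologicalSpace.IsSeparable.of_separableSpace U).exists_countable_dense_subset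
  have key : ∀ ω ∈ D, ∀ᵐ s ∂(intervalMeasure T), inner ℝ (b s) (ω - u s) ≤ 0 := by
    intro ω hω
    set k : ℝ → ℝ := fun s => inner ℝ (b s) (ω - u s) with hk
    have hkm : AEStronglyMeasurable k (intervalMeasure T) :=
      hb.1.inner (aestronglyMeasurable_const.sub (Lp.aestronglyMeasurable u))
    obtain ⟨k', hk'm, hkk'⟩ := hkm
    set S : Set ℝ := {s | 0 < k' s} with hS
    have hSm : MeasurableSet S := measurableSet_lt measurable_const hk'm.measurable
    -- The test control equals ω where k is positive (up to a null set) and u elsewhere, so the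
    -- integrand becomes max(k, 0). Its integral is at most 0, hence k ≤ 0 a.e.
    have hmem : MemLp (S.piecewise (fun _ => ω) u) ⊤ (intervalMeasure T) :=
      MemLp.piecewise hSm ((memLp_const ω).restrict S) ((Lp.memLp u).restrict Sᶜ)
    set v : Control m T := hmem.toLp _
    have hvs : v =ᵐ[intervalMeasure T] S.piecewise (fun _ => ω) u := hmem.coeFn_toLp
    have hv : v ∈ constrainedControls T U := by
      have hu' : ∀ᵐ t ∂(volume.restrict (Icc (0 : ℝ) T)), u t ∈ U := hu
      change ∀ᵐ t ∂(volume.restrict (Icc (0 : ℝ) T)), v t ∈ U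
      filter_upwards [hvs, hu'] with t h1 h2
      rw [h1]
      by_cases ht : t ∈ S
      · rw [piecewise_eq_of_mem _ _ _ ht]; exact hDU hω
      · rwa [piecewise_eq_of_notMem _ _ _ ht]
    have hle := h _ hv
    have e : (fun s => (inner ℝ (b s) ((v - u : Control m T) s) : ℝ))
        =ᵐ[intervalMeasure T] fun s => max (k s) 0 := by
      filter_upwards [hvs, Lp.coeFn_sub v u, hkk'] with s h1 h2 h3
      rw [h2, Pi.sub_apply, h1]
      by_cases hs : s ∈ S
      · have : 0 < k s := by rw [h3]; exact hs
        rw [piecewise_eq_of_mem _ _ _ hs, max_eq_left this.le]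
      · have : k s ≤ 0 := by rw [h3]; exact not_lt.1 hs
        rw [piecewise_eq_of_notMem _ _ _ hs, max_eq_right this, sub_self, inner_zero_right]
    have hint : Integrable (fun s => max (k s) 0) (intervalMeasure T) := by
      refine Integrable.congr ?_ e
      refine memLp_one_iff_integrable.1 (MemLp.mono_exponent (q := ⊤) ?_ le_top)
      exact (innerSL ℝ).memLp_of_bilin ⊤ hb (Lp.memLp (v - u))
    rw [integral_congr_ae e] at hle
    have h0 := (integral_eq_zero_iff_of_nonneg (fun s => le_max_right _ _) hint).1
      (le_antisymm hle (integral_nonneg fun s => le_max_right _ _))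
    filter_upwards [h0] with s hs
    exact max_eq_right_iff.1 hs
  filter_upwards [(ae_ball_iff hDc).2 key] with s hs ω hω
  exact closure_minimal (s := D) (t := {ω | inner ℝ (b s) (ω - u s) ≤ 0}) hs
    (isClosed_le (by fun_prop) continuous_const) (hD hω)

end ConstrainedControls

/-! ### Extending functions from [0,T] to the line -/

section Extension

variable {E : Type*} [NormedAddCommGroup E] [NormedSpace ℝ E] [CompleteSpace E]

/-- The extension by constants, obtained by projecting time to [0,T]. The primitives are constant
outside [0,T] as well, so the integral identity holds on the whole line. -/
theorem exists_boundedContinuous_extension {T : ℝ} (hT : 0 ≤ T) {z : ℝ → E}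
    (hz : AbsolutelyContinuousOnInterval z 0 T) :
    ∃ y : BoundedContinuousFunction ℝ E, (∀ t ∈ Icc 0 T, y t = z t) ∧
      ∀ h : Lp E ⊤ (intervalMeasure T), (∀ᵐ t ∂(intervalMeasure T), HasDerivAt z (h t) t) →
        y = BoundedContinuousFunction.const ℝ (z 0) + primitive T h := by
  have hc := hz.continuousOn
  rw [uIcc_of_le hT] at hc
  refine ⟨(BoundedContinuousFunction.mkOfCompact ⟨_, hc.domRestrict⟩).compContinuous
    ⟨projIcc 0 T hT, continuous_projIcc⟩, fun t ht => ?_, fun h hh => ?_⟩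
  · change z (projIcc 0 T hT t) = z t
    rw [projIcc_of_mem hT ht]
  · ext t
    change z (projIcc 0 T hT t) = z 0 + primitive T h t
    rw [primitive_apply_projIcc hT]
    exact eq_add_primitive_of_ae_hasDerivAt hz h hh (projIcc 0 T hT t).2

theorem ae_hasDerivAt_of_eq_const_add_primitive {T : ℝ} {y : BoundedContinuousFunction ℝ E} {c : E}
    {h : Lp E ⊤ (intervalMeasure T)}
    (hy : y = BoundedContinuousFunction.const ℝ c + primitive T h) :
    ∀ᵐ t ∂(intervalMeasure T), HasDerivAt y (h t) t := by
  subst hy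
  filter_upwards [ae_hasDerivAt_primitive h] with s hs
  exact hs.const_add c

omit [CompleteSpace E] in
theorem absolutelyContinuousOnInterval_of_eq_const_add_primitive {T : ℝ}
    {y : BoundedContinuousFunction ℝ E} {c : E} {h : Lp E ⊤ (intervalMeasure T)}
    (hy : y = BoundedContinuousFunction.const ℝ c + primitive T h) (a b : ℝ) :
    AbsolutelyContinuousOnInterval y a b := by
  subst hy
  refine LipschitzOnWith.absolutelyContinuousOnInterval (K := ‖h‖₊)
    (LipschitzWith.of_dist_le_mul fun s t => ?_).lipschitzOnWith
  simpa using (lipschitzWith_primitive h).dist_le_mul s t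

end Extension

/-! ### Gradients as adjoints -/

section Gradient

variable {E H : Type*} [NormedAddCommGroup E] [InnerProductSpace ℝ E] [CompleteSpace E]
  [NormedAddCommGroup H] [InnerProductSpace ℝ H] [CompleteSpace H]

theorem gradient_inner_eq_adjoint {Φ : H → E} {L : H →L[ℝ] E} {x : H}
    (h : HasFDerivAt Φ L x) (p : E) :
    gradient (fun y => (inner ℝ p (Φ y) : ℝ)) x = L.adjoint p := by
  refine HasGradientAt.gradient ?_
  rw [hasGradientAt_iff_hasFDerivAt]
  have := (innerSL ℝ p).hasFDerivAt.comp x h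
  convert! this using 1
  ext w
  simp [ContinuousLinearMap.adjoint_inner_left]

end Gradient

/-! ### Trajectories and the differential of the end-point map -/

section Dynamics

variable {n m : ℕ}
  {f : EuclideanSpace ℝ (Fin n) → EuclideanSpace ℝ (Fin m) → ℝ → EuclideanSpace ℝ (Fin n)}
  {T : ℝ} {x0 : EuclideanSpace ℝ (Fin n)} {u : Control m T}

/-- The dynamics with time clamped to `[0,T]`. -/
noncomputable def clampedDynamics
    (f : EuclideanSpace ℝ (Fin n) → EuclideanSpace ℝ (Fin m) → ℝ → EuclideanSpace ℝ (Fin n))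
    (hT : 0 ≤ T) (q : (EuclideanSpace ℝ (Fin n) × EuclideanSpace ℝ (Fin m)) × ℝ) :
    EuclideanSpace ℝ (Fin n) :=
  f q.1.1 q.1.2 (projIcc 0 T hT q.2)

theorem clampedDynamics_of_mem (hT : 0 ≤ T)
    (z : EuclideanSpace ℝ (Fin n) × EuclideanSpace ℝ (Fin m)) {t : ℝ} (ht : t ∈ Icc 0 T) :
    clampedDynamics f hT (z, t) = f z.1 z.2 t := by
  simp only [clampedDynamics, projIcc_of_mem hT ht]

theorem IsC1Dynamics.continuous_clampedDynamics (hf : IsC1Dynamics f T) (hT : 0 ≤ T) :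
    Continuous (clampedDynamics f hT) :=
  hf.continuousOn.comp_continuous
    (f := fun q : (EuclideanSpace ℝ (Fin n) × EuclideanSpace ℝ (Fin m)) × ℝ =>
      (q.1, (projIcc 0 T hT q.2 : ℝ)))
    (continuous_fst.prodMk (continuous_subtype_val.comp (continuous_projIcc.comp continuous_snd)))
    (fun q => ⟨mem_univ _, (projIcc 0 T hT q.2).2⟩)

theorem IsC1Dynamics.differentiable_clampedDynamics (hf : IsC1Dynamics f T) (hT : 0 ≤ T) (t : ℝ) :
    Differentiable ℝ fun z => clampedDynamics f hT (z, t) :=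
  hf.differentiable _ (projIcc 0 T hT t).2

theorem IsC1Dynamics.continuous_fderiv_clampedDynamics (hf : IsC1Dynamics f T) (hT : 0 ≤ T) :
    Continuous fun q : (EuclideanSpace ℝ (Fin n) × EuclideanSpace ℝ (Fin m)) × ℝ =>
      fderiv ℝ (fun z => clampedDynamics f hT (z, q.2)) q.1 :=
  hf.continuousOn_fderiv.comp_continuous
    (f := fun q : (EuclideanSpace ℝ (Fin n) × EuclideanSpace ℝ (Fin m)) × ℝ =>
      (q.1, (projIcc 0 T hT q.2 : ℝ)))
    (continuous_fst.prodMk (continuous_subtype_val.comp (continuous_projIcc.comp continuous_snd)))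
    (fun q => ⟨mem_univ _, (projIcc 0 T hT q.2).2⟩)

theorem coeFn_superposition_clampedDynamics (hT : 0 ≤ T) (hg : Continuous (clampedDynamics f hT))
    (v : Control m T) (y : BoundedContinuousFunction ℝ (EuclideanSpace ℝ (Fin n))) :
    superposition T hg (stateControl T (v, y)) =ᵐ[intervalMeasure T]
      fun s => f (y s) (v s) s := by
  filter_upwards [coeFn_superposition hg (stateControl T (v, y)), coeFn_stateControl v y,
    ae_restrict_mem measurableSet_Icc] with s h1 h2 hs
  rw [h1, h2, clampedDynamics_of_mem hT _ hs]

theorem IsTrajectory.exists_integralDefect_eq_zero (hT : 0 ≤ T)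
    (hg : Continuous (clampedDynamics f hT)) {v : Control m T}
    {x : ℝ → EuclideanSpace ℝ (Fin n)} (hx : IsTrajectory f T x0 v x) :
    ∃ y : BoundedContinuousFunction ℝ (EuclideanSpace ℝ (Fin n)),
      (∀ t ∈ Icc 0 T, y t = x t) ∧ integralDefect T hg x0 (v, y) = 0 := by
  obtain ⟨y, hyx, hy⟩ := exists_boundedContinuous_extension hT hx.absolutelyContinuous
  refine ⟨y, hyx, (integralDefect_eq_zero_iff hg x0 v y).2 ?_⟩
  rw [← hx.initial]
  refine hy _ ?_
  filter_upwards [hx.ode, coeFn_superposition_clampedDynamics hT hg v y,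
    ae_restrict_mem measurableSet_Icc] with s h1 h2 hs
  rwa [h2, hyx s hs]

theorem isTrajectory_of_integralDefect_eq_zero (hT : 0 ≤ T)
    (hg : Continuous (clampedDynamics f hT)) {v : Control m T}
    {y : BoundedContinuousFunction ℝ (EuclideanSpace ℝ (Fin n))}
    (hy : integralDefect T hg x0 (v, y) = 0) : IsTrajectory f T x0 v y := by
  rw [integralDefect_eq_zero_iff] at hy
  refine ⟨absolutelyContinuousOnInterval_of_eq_const_add_primitive hy 0 T, ?_, ?_⟩
  · rw [hy]; simp
  · filter_upwards [ae_hasDerivAt_of_eq_const_add_primitive hy,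
      coeFn_superposition_clampedDynamics hT hg v y] with s h1 h2
    rwa [h2] at h1

/-- Uniqueness for the integral equation makes the choice in `trajectory` immaterial on [0,T]. -/
theorem IsC1Dynamics.trajectory_eq (hf : IsC1Dynamics f T) (hT : 0 ≤ T) {v : Control m T}
    {y : BoundedContinuousFunction ℝ (EuclideanSpace ℝ (Fin n))}
    (hy : integralDefect T (hf.continuous_clampedDynamics hT) x0 (v, y) = 0) {t : ℝ}
    (ht : t ∈ Icc 0 T) : trajectory f T x0 v t = y t := by
  have hex : ∃ x, IsTrajectory f T x0 v x := ⟨y, isTrajectory_of_integralDefect_eq_zero hT _ hy⟩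
  have htr : IsTrajectory f T x0 v (trajectory f T x0 v) := by
    rw [trajectory, dif_pos hex]
    exact hex.choose_spec
  obtain ⟨z, hz, hz'⟩ := htr.exists_integralDefect_eq_zero hT (hf.continuous_clampedDynamics hT)
  rw [← hz t ht, integralDefect_unique hT _ (hf.differentiable_clampedDynamics hT)
    (hf.continuous_fderiv_clampedDynamics hT) hz' hy]

/-- Near an admissible control all controls are admissible, and the end-point mapping is
differentiable with differential given by the linearized equation. -/
theorem IsC1Dynamics.hasFDerivAt_endpointMap (hf : IsC1Dynamics f T) (hT : 0 ≤ T)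
    {y : BoundedContinuousFunction ℝ (EuclideanSpace ℝ (Fin n))}
    (hy : integralDefect T (hf.continuous_clampedDynamics hT) x0 (u, y) = 0) :
    admissibleControls f T x0 ∈ 𝓝 u ∧ DifferentiableAt ℝ (endpointMap f T x0) u ∧
      ∀ w, ∃ ξ : BoundedContinuousFunction ℝ (EuclideanSpace ℝ (Fin n)),
        fderiv ℝ (endpointMap f T x0) u w = ξ T ∧
        ξ = primitive T (pointwiseApply (superposition T
          (hf.continuous_fderiv_clampedDynamics hT) (stateControl T (u, y)))
            (stateControl T (w, ξ))) := by
  obtain ⟨φ, φ', hφ, hφe, hφ'⟩ := exists_hasStrictFDerivAt_solution hT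
    (hf.continuous_clampedDynamics hT) (hf.differentiable_clampedDynamics hT)
    (hf.continuous_fderiv_clampedDynamics hT) hy
  have hE : HasFDerivAt (endpointMap f T x0)
      ((BoundedContinuousFunction.evalCLM ℝ T) ∘L φ') u := by
    have h1 := (BoundedContinuousFunction.evalCLM ℝ T
      (β := EuclideanSpace ℝ (Fin n))).hasFDerivAt.comp u hφ.hasFDerivAt
    -- The end-point map agrees with v ↦ φ(v)(T) only near u, which suffices for the derivative.
    refine h1.congr_of_eventuallyEq ?_
    filter_upwards [hφe] with v hv
    exact hf.trajectory_eq hT hv ⟨hT, le_rfl⟩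
  refine ⟨?_, hE.differentiableAt, fun w => ⟨φ' w, ?_, hφ' w⟩⟩
  · filter_upwards [hφe] with v hv
    exact ⟨φ v, isTrajectory_of_integralDefect_eq_zero hT _ hv⟩
  · rw [hE.fderiv]; rfl

theorem IsC1Dynamics.gradient_hamiltonian_state (hf : IsC1Dynamics f T) (hT : 0 ≤ T) {t : ℝ}
    (ht : t ∈ Icc 0 T) (x p : EuclideanSpace ℝ (Fin n)) (v : EuclideanSpace ℝ (Fin m)) :
    gradient (fun y => hamiltonian f y v p t) x =
      (fderivState (clampedDynamics f hT) ((x, v), t)).adjoint p := by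
  have h1 : HasFDerivAt (fun z => clampedDynamics f hT (z, t))
      (fderiv ℝ (fun z => clampedDynamics f hT (z, t)) (x, v)) (x, v) :=
    (hf.differentiable_clampedDynamics hT t (x, v)).hasFDerivAt
  have h2 := gradient_inner_eq_adjoint (h1.comp x (hasFDerivAt_prodMk_left x v)) p
  simp only [Function.comp_def, clampedDynamics_of_mem hT _ ht] at h2
  simpa only [hamiltonian, fderivState, clampedDynamics_of_mem hT _ ht] using h2

/-- The partial differential of the dynamics with respect to the control. -/
noncomputable def fderivControl
    (g : (EuclideanSpace ℝ (Fin n) × EuclideanSpace ℝ (Fin m)) × ℝ → EuclideanSpace ℝ (Fin n))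
    (q : (EuclideanSpace ℝ (Fin n) × EuclideanSpace ℝ (Fin m)) × ℝ) :
    EuclideanSpace ℝ (Fin m) →L[ℝ] EuclideanSpace ℝ (Fin n) :=
  fderiv ℝ (fun z => g (z, q.2)) q.1 ∘L ContinuousLinearMap.inr ℝ _ _

theorem IsC1Dynamics.gradient_hamiltonian_control (hf : IsC1Dynamics f T) (hT : 0 ≤ T) {t : ℝ}
    (ht : t ∈ Icc 0 T) (x p : EuclideanSpace ℝ (Fin n)) (v : EuclideanSpace ℝ (Fin m)) :
    gradient (fun w => hamiltonian f x w p t) v =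
      (fderivControl (clampedDynamics f hT) ((x, v), t)).adjoint p := by
  have h1 : HasFDerivAt (fun z => clampedDynamics f hT (z, t))
      (fderiv ℝ (fun z => clampedDynamics f hT (z, t)) (x, v)) (x, v) :=
    (hf.differentiable_clampedDynamics hT t (x, v)).hasFDerivAt
  have h2 := gradient_inner_eq_adjoint (h1.comp v (hasFDerivAt_prodMk_right x v)) p
  simp only [Function.comp_def, clampedDynamics_of_mem hT _ ht] at h2
  simpa only [hamiltonian, fderivControl, clampedDynamics_of_mem hT _ ht] using h2

end Dynamics

/-! ### Extremal lifts and the equivalence -/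

section Extremals

variable {n m : ℕ}
  {f : EuclideanSpace ℝ (Fin n) → EuclideanSpace ℝ (Fin m) → ℝ → EuclideanSpace ℝ (Fin n)}
  {T : ℝ} {x0 : EuclideanSpace ℝ (Fin n)} {U : Set (EuclideanSpace ℝ (Fin m))} {u : Control m T}

theorem IsC1Dynamics.continuous_neg_adjoint_fderivState (hf : IsC1Dynamics f T) (hT : 0 ≤ T) :
    Continuous fun q => -(fderivState (clampedDynamics f hT) q).adjoint :=
  ((ContinuousLinearMap.adjoint (𝕜 := ℝ) (E := EuclideanSpace ℝ (Fin n))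
    (F := EuclideanSpace ℝ (Fin n))).continuous.comp
      (continuous_fderivState _ (hf.continuous_fderiv_clampedDynamics hT))).neg

theorem IsC1Dynamics.continuous_adjoint_fderivControl (hf : IsC1Dynamics f T) (hT : 0 ≤ T) :
    Continuous fun q => (fderivControl (clampedDynamics f hT) q).adjoint :=
  (ContinuousLinearMap.adjoint (𝕜 := ℝ) (E := EuclideanSpace ℝ (Fin m))
    (F := EuclideanSpace ℝ (Fin n))).continuous.comp
      ((hf.continuous_fderiv_clampedDynamics hT).clm_comp continuous_const)

/-- The matrix of the adjoint equation along the pair `(y, u)`. -/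
noncomputable def IsC1Dynamics.adjointCoefficient (hf : IsC1Dynamics f T) (hT : 0 ≤ T)
    (u : Control m T) (y : BoundedContinuousFunction ℝ (EuclideanSpace ℝ (Fin n))) :
    Lp (EuclideanSpace ℝ (Fin n) →L[ℝ] EuclideanSpace ℝ (Fin n)) ⊤ (intervalMeasure T) :=
  superposition T (hf.continuous_neg_adjoint_fderivState hT) (stateControl T (u, y))

/-- The gradient of the Hamiltonian in the control along the pair `(y, u)` and the covector `p`. -/
noncomputable def IsC1Dynamics.controlGradient (hf : IsC1Dynamics f T) (hT : 0 ≤ T)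
    (u : Control m T) (y p : BoundedContinuousFunction ℝ (EuclideanSpace ℝ (Fin n))) :
    Lp (EuclideanSpace ℝ (Fin m)) ⊤ (intervalMeasure T) :=
  pointwiseApply (superposition T (hf.continuous_adjoint_fderivControl hT) (stateControl T (u, y)))
    (restrictLp T p)

theorem IsC1Dynamics.coeFn_adjointCoefficient (hf : IsC1Dynamics f T) (hT : 0 ≤ T)
    (u : Control m T) (y : BoundedContinuousFunction ℝ (EuclideanSpace ℝ (Fin n))) :
    hf.adjointCoefficient hT u y =ᵐ[intervalMeasure T]
      fun s => -(fderivState (clampedDynamics f hT) ((y s, u s), s)).adjoint := by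
  filter_upwards [coeFn_superposition (hf.continuous_neg_adjoint_fderivState hT)
    (stateControl T (u, y)), coeFn_stateControl u y] with s h1 h2
  rw [adjointCoefficient, h1, h2]

theorem IsC1Dynamics.coeFn_controlGradient (hf : IsC1Dynamics f T) (hT : 0 ≤ T)
    (u : Control m T) (y p : BoundedContinuousFunction ℝ (EuclideanSpace ℝ (Fin n))) :
    hf.controlGradient hT u y p =ᵐ[intervalMeasure T]
      fun s => (fderivControl (clampedDynamics f hT) ((y s, u s), s)).adjoint (p s) := by
  filter_upwards [coeFn_pointwiseApply (superposition T (hf.continuous_adjoint_fderivControl hT)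
      (stateControl T (u, y))) (restrictLp T p), coeFn_restrictLp (T := T) p,
    coeFn_superposition (hf.continuous_adjoint_fderivControl hT) (stateControl T (u, y)),
    coeFn_stateControl u y] with s h1 h2 h3 h4
  rw [controlGradient, h1, h2, h3, h4]

/-- A solution of the adjoint equation tests the differential of the end-point mapping. -/
theorem IsC1Dynamics.inner_fderiv_endpointMap (hf : IsC1Dynamics f T) (hT : 0 ≤ T)
    {y p : BoundedContinuousFunction ℝ (EuclideanSpace ℝ (Fin n))} {q : EuclideanSpace ℝ (Fin n)}
    (hy : integralDefect T (hf.continuous_clampedDynamics hT) x0 (u, y) = 0)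
    (hp : p = BoundedContinuousFunction.const ℝ q +
      primitive T (pointwiseApply (hf.adjointCoefficient hT u y) (restrictLp T p)))
    (w : Control m T) :
    inner ℝ (p T) (fderiv ℝ (endpointMap f T x0) u w) =
      ∫ s, inner ℝ (hf.controlGradient hT u y p s) (w s) ∂(intervalMeasure T) := by
  obtain ⟨-, -, h⟩ := hf.hasFDerivAt_endpointMap hT hy
  obtain ⟨ξ, h1, h2⟩ := h w
  rw [h1]
  have hD := coeFn_superposition (hf.continuous_fderiv_clampedDynamics hT) (stateControl T (u, y))
  have hs := coeFn_stateControl u y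
  rw [inner_linearized_eq_integral hT ?_ hp h2]
  · refine integral_congr_ae ?_
    filter_upwards [hD, hs, hf.coeFn_controlGradient hT u y p] with s e1 e2 e3
    rw [e3, e1, e2]
    rfl
  · filter_upwards [hD, hs, hf.coeFn_adjointCoefficient hT u y] with s e1 e2 e3
    rw [e3, e1, e2]
    rfl

theorem IsC1Dynamics.isWeakUExtremalLift_of_adjoint (hf : IsC1Dynamics f T) (hT : 0 ≤ T)
    {y p : BoundedContinuousFunction ℝ (EuclideanSpace ℝ (Fin n))} {q : EuclideanSpace ℝ (Fin n)}
    (hy : integralDefect T (hf.continuous_clampedDynamics hT) x0 (u, y) = 0)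
    (hp : p = BoundedContinuousFunction.const ℝ q +
      primitive T (pointwiseApply (hf.adjointCoefficient hT u y) (restrictLp T p)))
    (hN : ∀ᵐ s ∂(intervalMeasure T), hf.controlGradient hT u y p s ∈ normalCone U (u s)) :
    IsWeakUExtremalLift f T U (trajectory f T x0 u) u p := by
  refine ⟨absolutelyContinuousOnInterval_of_eq_const_add_primitive hp 0 T, ?_, ?_⟩
  · filter_upwards [ae_hasDerivAt_of_eq_const_add_primitive hp,
      coeFn_pointwiseApply (hf.adjointCoefficient hT u y) (restrictLp T p),
      coeFn_restrictLp (T := T) p, hf.coeFn_adjointCoefficient hT u y,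
      ae_restrict_mem measurableSet_Icc] with s h1 h2 h3 h4 hs
    rw [hf.trajectory_eq hT hy hs, hf.gradient_hamiltonian_state hT hs]
    rw [h2, h3, h4] at h1
    exact h1
  · filter_upwards [hN, hf.coeFn_controlGradient hT u y p,
      ae_restrict_mem measurableSet_Icc] with s h1 h2 hs
    rw [hf.trajectory_eq hT hy hs, hf.gradient_hamiltonian_control hT hs, ← h2]
    exact h1

/-- Puts an arbitrary lift, controlled only on [0,T], into the integral form that the duality
formula requires. -/
theorem IsWeakUExtremalLift.exists_adjoint (hf : IsC1Dynamics f T) (hT : 0 ≤ T)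
    {y : BoundedContinuousFunction ℝ (EuclideanSpace ℝ (Fin n))}
    {p : ℝ → EuclideanSpace ℝ (Fin n)}
    (hy : integralDefect T (hf.continuous_clampedDynamics hT) x0 (u, y) = 0)
    (hp : IsWeakUExtremalLift f T U (trajectory f T x0 u) u p) :
    ∃ r : BoundedContinuousFunction ℝ (EuclideanSpace ℝ (Fin n)), (∀ t ∈ Icc 0 T, r t = p t) ∧
      r = BoundedContinuousFunction.const ℝ (p 0) +
        primitive T (pointwiseApply (hf.adjointCoefficient hT u y) (restrictLp T r)) ∧
      ∀ᵐ s ∂(intervalMeasure T), hf.controlGradient hT u y r s ∈ normalCone U (u s) := by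
  obtain ⟨r, hrp, hr⟩ := exists_boundedContinuous_extension hT hp.absolutelyContinuous
  refine ⟨r, hrp, hr _ ?_, ?_⟩
  · filter_upwards [hp.adjoint_equation,
      coeFn_pointwiseApply (hf.adjointCoefficient hT u y) (restrictLp T r),
      coeFn_restrictLp (T := T) r, hf.coeFn_adjointCoefficient hT u y,
      ae_restrict_mem measurableSet_Icc] with s h1 h2 h3 h4 hs
    rw [hf.trajectory_eq hT hy hs, hf.gradient_hamiltonian_state hT hs] at h1
    rw [h2, h3, h4, hrp s hs]
    exact h1
  · filter_upwards [hp.hamiltonian_gradient, hf.coeFn_controlGradient hT u y r,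
      ae_restrict_mem measurableSet_Icc] with s h1 h2 hs
    rw [hf.trajectory_eq hT hy hs, hf.gradient_hamiltonian_control hT hs] at h1
    rw [h2, hrp s hs]
    exact h1

/-- A weakly singular control admits a nontrivial weak extremal lift. -/
theorem IsWeaklyUSingular.exists_lift (hf : IsC1Dynamics f T) (hT : 0 ≤ T) (hU : Convex ℝ U)
    (hu : u ∈ constrainedControls T U)
    {y : BoundedContinuousFunction ℝ (EuclideanSpace ℝ (Fin n))}
    (hy : integralDefect T (hf.continuous_clampedDynamics hT) x0 (u, y) = 0)
    (h : IsWeaklyUSingular f T x0 U u) :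
    ∃ p : ℝ → EuclideanSpace ℝ (Fin n),
      IsWeakUExtremalLift f T U (trajectory f T x0 u) u p ∧ ∃ t ∈ Icc (0 : ℝ) T, p t ≠ 0 := by
  set E' := fderiv ℝ (endpointMap f T x0) u with hE'
  obtain ⟨ψ, hψ0, hψ⟩ := exists_inner_nonpos_of_convex_cone_ne_univ
    (C := E' '' tangentCone T U u) ((convex_tangentCone hU hu).is_linear_image E'.isLinear)
    ⟨0, zero_mem_tangentCone hu, map_zero _⟩
    (by
      rintro a ha _ ⟨w, hw, rfl⟩
      exact ⟨a • w, smul_mem_tangentCone hw ha, map_smul _ _ _⟩) h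
  obtain ⟨p, q, hpT, hp⟩ := exists_adjoint_solution hT
    (A := superposition T (continuous_fderivState (clampedDynamics f hT)
      (hf.continuous_fderiv_clampedDynamics hT)) (stateControl T (u, y)))
    (P := hf.adjointCoefficient hT u y) (by
      filter_upwards [hf.coeFn_adjointCoefficient hT u y, coeFn_stateControl u y,
        coeFn_superposition (continuous_fderivState (clampedDynamics f hT)
          (hf.continuous_fderiv_clampedDynamics hT)) (stateControl T (u, y))] with s h1 h2 h3
      rw [h1, h3, h2]) ψ
  refine ⟨p, hf.isWeakUExtremalLift_of_adjoint hT hy hp ?_, T, ⟨hT, le_rfl⟩, by rwa [hpT]⟩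
  refine ae_mem_normalCone_of_integral_nonpos (Lp.memLp _) hu fun v hv => ?_
  rw [← hf.inner_fderiv_endpointMap hT hy hp, hpT]
  exact hψ _ ⟨v - u, ⟨1, zero_le_one, v, hv, (one_smul _ _).symm⟩, rfl⟩

/-- A control with a nontrivial weak extremal lift is weakly singular. -/
theorem IsWeakUExtremalLift.isWeaklyUSingular (hf : IsC1Dynamics f T) (hT : 0 ≤ T)
    {y : BoundedContinuousFunction ℝ (EuclideanSpace ℝ (Fin n))}
    {p : ℝ → EuclideanSpace ℝ (Fin n)}
    (hy : integralDefect T (hf.continuous_clampedDynamics hT) x0 (u, y) = 0)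
    (hp : IsWeakUExtremalLift f T U (trajectory f T x0 u) u p)
    (hne : ∃ t ∈ Icc (0 : ℝ) T, p t ≠ 0) : IsWeaklyUSingular f T x0 U u := by
  obtain ⟨r, hrp, hr, hN⟩ := hp.exists_adjoint hf hT hy
  -- Nontriviality at some time gives it at T: if r(T) = 0, then r(0) = 0 by duality, and r vanishes
  -- identically by uniqueness.
  have hrT : r T ≠ 0 := by
    intro h0
    have hq := adjoint_initial_eq_zero hT
      (A := superposition T (continuous_fderivState (clampedDynamics f hT)
        (hf.continuous_fderiv_clampedDynamics hT)) (stateControl T (u, y)))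
      (P := hf.adjointCoefficient hT u y) (by
        filter_upwards [hf.coeFn_adjointCoefficient hT u y, coeFn_stateControl u y,
          coeFn_superposition (continuous_fderivState (clampedDynamics f hT)
            (hf.continuous_fderiv_clampedDynamics hT)) (stateControl T (u, y))] with s h1 h2 h3
        rw [h1, h3, h2]) hr h0
    rw [hq, show BoundedContinuousFunction.const ℝ (0 : EuclideanSpace ℝ (Fin n)) = 0 from rfl,
      zero_add] at hr
    have hr0 := linear_solution_eq_zero hT hr
    obtain ⟨t, ht, hpt⟩ := hne
    rw [← hrp t ht, hr0] at hpt
    exact hpt rfl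
  intro hreg
  have hmem : r T ∈ (fderiv ℝ (endpointMap f T x0) u) '' tangentCone T U u := by
    rw [show (fderiv ℝ (endpointMap f T x0) u) '' tangentCone T U u = univ from hreg]
    exact mem_univ _
  obtain ⟨_, ⟨α, hα, v, hv, rfl⟩, hw⟩ := hmem
  have key := hf.inner_fderiv_endpointMap hT hy hr (v - u)
  rw [map_smul] at hw
  have hle : inner ℝ (r T) (fderiv ℝ (endpointMap f T x0) u (v - u)) ≤ (0 : ℝ) := by
    rw [key]
    refine integral_nonpos_of_ae ?_
    have hv' : ∀ᵐ t ∂(intervalMeasure T), v t ∈ U := hv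
    filter_upwards [hN, hv', Lp.coeFn_sub v u] with s h1 h2 h3
    rw [h3, Pi.sub_apply]
    exact h1 _ h2
  have hpos : (0 : ℝ) < inner ℝ (r T) (r T) := real_inner_self_pos.2 hrT
  -- Writing one factor r(T) as α · DE(u)(v - u) turns ‖r(T)‖² > 0 into α times a nonpositive
  -- number.
  nth_rewrite 2 [← hw] at hpos
  rw [inner_smul_right] at hpos
  exact absurd hpos (not_lt.2 (mul_nonpos_of_nonneg_of_nonpos hα hle))

end Extremals

end ControlSystem

theorem proposition4 (n m : ℕ) (T : ℝ) (hT : 0 < T)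
    (f : EuclideanSpace ℝ (Fin n) → EuclideanSpace ℝ (Fin m) → ℝ → EuclideanSpace ℝ (Fin n))
    (hf : ControlSystem.IsC1Dynamics f T)
    (x0 : EuclideanSpace ℝ (Fin n))
    (U : Set (EuclideanSpace ℝ (Fin m))) (hU : Convex ℝ U)
    (u : ControlSystem.Control m T)
    (hu : u ∈ ControlSystem.admissibleControls f T x0 ∩ ControlSystem.constrainedControls T U) :
    ControlSystem.admissibleControls f T x0 ∈ 𝓝 u ∧
    DifferentiableAt ℝ (ControlSystem.endpointMap f T x0) u ∧
    (ControlSystem.IsWeaklyUSingular f T x0 U u ↔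
      ∃ p : ℝ → EuclideanSpace ℝ (Fin n),
        ControlSystem.IsWeakUExtremalLift f T U (ControlSystem.trajectory f T x0 u) u p ∧
        ∃ t ∈ Icc (0 : ℝ) T, p t ≠ 0) := by
  obtain ⟨⟨x, hx⟩, huU⟩ := hu
  obtain ⟨y, -, hy⟩ := hx.exists_integralDefect_eq_zero hT.le (hf.continuous_clampedDynamics hT.le)
  obtain ⟨h1, h2, -⟩ := hf.hasFDerivAt_endpointMap hT.le hy
  exact ⟨h1, h2, fun h => h.exists_lift hf hT.le hU huU hy,
    fun ⟨_, hp, hne⟩ => hp.isWeaklyUSingular hf hT.le hy hne⟩
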